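/- Let $\mathcal A$ be a complete abelian category with an injective cogenerator $Q$. Write $\mathbf K(\mathcal A)$ for the homotopy category of (unbounded, cohomologically graded) complexes over $\mathcal A$ and $\mathbf D(\mathcal A)$ for the derived category. A complex $X$ is *homotopically injective* if $\mathbf K(\mathcal A)(N,X)=0$ for every acyclic complex $N$; $\mathbf K_{inj}(\mathcal A)\subseteq\mathbf K(\mathcal A)$ is the full subcategory of these complexes. A *homotopically injective resolution* of $X$ is a quasi-isomorphism $X\to E$ in $\mathbf K(\mathcal A)$ with $E$ homotopically injective. A *Cartan–Eilenberg injective resolution* of a complex $X$ is a double complex $E^{\bullet,\bullet}=(E^{i,j})_{i\in\mathbb Z,\,j\ge 0}$ with commuting differentials $d_v:E^{i,j}\to E^{i+1,j}$, $d_h:E^{i,j}\to E^{i,j+1}$, together with an augmentation $X\to E^{\bullet,0}$ of complexes whose composite with $d_h$ is zero, such that for every $i\in\mathbb Z$ the induced augmented complexes $0\to X^i\to E^{i,0}\to E^{i,1}\to\cdots$, $0\to B^i(X)\to B^i(E^{\bullet,0})\to B^i(E^{\bullet,1})\to\cdots$, $0\to Z^i(X)\to Z^i(E^{\bullet,0})\to\cdots$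 and $0\to H^i(X)\to H^i(E^{\bullet,0})\to\cdots$ (boundaries, cocycles and cohomology of the columns) are injective resolutions. Its cototalization $\mathrm{Cot}(E)$ is the product total complex, $\mathrm{Cot}(E)^n=\prod_{i+j=n}E^{i,j}$, with differential whose component in $E^{i,j}$ is $d_v+(-1)^i d_h$; the augmentation induces a map of complexes $X\to\mathrm{Cot}(E)$. Suppose that $\mathbf D(\mathcal A)$ has products, and that for every complex $X$ over $\mathcal A$ and every Cartan–Eilenberg injective resolution $X\to E^{\bullet,\bullet}$ the map $X\to\mathrm{Cot}(E)$ is a homotopically injective resolution. Then: (1) Every object of $\mathbf K(\mathcal A)$ has a homotopically injective resolution. (2) The composite $\mathbf K_{inj}(\mathcal A)\hookrightarrow\mathbf K(\mathcal A)\to\mathbf D(\mathcal A)$ is an equivalence of categories; hence $\mathbf D(\mathcal A)$ has small hom-sets. (3) Every left exact (additive) functor $F:\mathcal A\to\mathcal B$ to another abelian category $\mathcal B$ has a total right derived functor: a triangulated functor $\mathbf RF:\mathbf D(\mathcal A)\to\mathbf D(\mathcal B)$ with a natural transformation of triangulated functors from $\mathbf K(\mathcal A)\xrightarrow{F}\mathbf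 K(\mathcal B)\to\mathbf D(\mathcal B)$ to $\mathbf K(\mathcal A)\to\mathbf D(\mathcal A)\xrightarrow{\mathbf RF}\mathbf D(\mathcal B)$ which is universal (a left Kan extension along $\mathbf K(\mathcal A)\to\mathbf D(\mathcal A)$). (4) $\mathbf D(\mathcal A)^{op}$ satisfies Brown representability: every homological functor $\mathbf D(\mathcal A)\to\mathbf{Ab}$ that preserves products is isomorphic to $\mathbf D(\mathcal A)(X,-)$ for some object $X$. (5) Every object of $\mathbf K_{inj}(\mathcal A)$ is $\mathcal S$-cofiltered for the set $\mathcal S=\{Q[n]\mid n\in\mathbb Z\}$. That is, in the triangulated category $\mathbf K_{inj}(\mathcal A)$ it is a homotopy limit of a tower $\cdots\to X_2\to X_1\to X_0$ (it is the first term of a distinguished triangle $X\to\prod_n X_n\xrightarrow{1-\mathrm{shift}}\prod_n X_n\to X[1]$), where $X_0$ is a direct factor of a product of objects of $\mathcal S$ and for each $n$ there is a distinguished triangle $P_n\to X_{n+1}\to X_n\to P_n[1]$ with $P_n$ a direct factor of a product of objects of $\mathcal S$. -/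

import Mathlib

open CategoryTheory Limits Pretriangulated

universe w v u w' v' u'

noncomputable section

namespace CartanEilenberg

/-! ### Double complexes, cototalization, Cartan–Eilenberg injective resolutions -/

section Cototalization

variable {A : Type u} [Category.{v} A] [Abelian A]

/-- Double complexes `E^{i,j}` with `i : ℤ` and `j : ℕ` (that is, vanishing for `j < 0`), with
commuting differentials. The column `E^{•,j}` is the cochain complex `E.X j`, so that
`E^{i,j}` is `(E.X j).X i`, the vertical differential is `(E.X j).d i (i + 1)`, and the horizontal
one is `(E.d j (j + 1)).f i`. -/
abbrev DoubleComplex (A : Type u) [Category.{v} A] [Abelian A] :=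
  CochainComplex (CochainComplex A ℤ) ℕ

/-- The positions `(i, j)` on the antidiagonal `i + j = n`. -/
abbrev Antidiag (n : ℤ) : Type := {p : ℤ × ℕ // p.1 + p.2 = n}

variable [HasLimits A]

/-- The degree `n` part `∏_{i + j = n} E^{i,j}` of the cototalization. -/
def cotX (E : DoubleComplex A) (n : ℤ) : A :=
  ∏ᶜ fun p : Antidiag n => (E.X p.1.2).X p.1.1

/-- The projection of `∏_{i + j = n} E^{i,j}` to the component `E^{i,j}`. -/
def cotπ (E : DoubleComplex A) (n i : ℤ) (j : ℕ) (h : i + j = n) :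
    cotX E n ⟶ (E.X j).X i :=
  Pi.π (fun p : Antidiag n => (E.X p.1.2).X p.1.1) ⟨(i, j), h⟩

/-- The map into `∏_{i + j = n} E^{i,j}` with given components. -/
def cotLift (E : DoubleComplex A) (n : ℤ) {Z : A}
    (f : ∀ (i : ℤ) (j : ℕ), i + j = n → (Z ⟶ (E.X j).X i)) : Z ⟶ cotX E n :=
  Pi.lift fun p : Antidiag n => f p.1.1 p.1.2 p.2

@[simp]
lemma cotLift_π (E : DoubleComplex A) (n : ℤ) {Z : A}
    (f : ∀ (i : ℤ) (j : ℕ), i + j = n → (Z ⟶ (E.X j).X i)) (i : ℤ) (j : ℕ) (h : i + j = n) :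
    cotLift E n f ≫ cotπ E n i j h = f i j h := by
  exact Pi.lift_π _ (⟨(i, j), h⟩ : Antidiag n)

lemma cot_hom_ext (E : DoubleComplex A) (n : ℤ) {Z : A} (f g : Z ⟶ cotX E n)
    (hfg : ∀ (i : ℤ) (j : ℕ) (h : i + j = n), f ≫ cotπ E n i j h = g ≫ cotπ E n i j h) :
    f = g :=
  Pi.hom_ext _ _ fun p => hfg p.1.1 p.1.2 p.2

/-- The component `∏_{i + j = n} E^{i,j} ⟶ E^{i,j}`, for `i + j = n + 1`, of the differential of
the cototalization: the vertical differential from `E^{i-1,j}` plus `(-1)^i` times the horizontal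
differential from `E^{i,j-1}` (which is absent if `j = 0`). -/
def cotDComp (E : DoubleComplex A) (n i : ℤ) :
    ∀ (j : ℕ), i + j = n + 1 → (cotX E n ⟶ (E.X j).X i)
  | 0, h => cotπ E n (i - 1) 0 (by omega) ≫ (E.X 0).d (i - 1) i
  | k + 1, h => cotπ E n (i - 1) (k + 1) (by omega) ≫ (E.X (k + 1)).d (i - 1) i +
      i.negOnePow • (cotπ E n i k (by push_cast at h; omega) ≫ (E.d k (k + 1)).f i)

/-- The differential of the cototalization. -/
def cotD (E : DoubleComplex A) (n : ℤ) : cotX E n ⟶ cotX E (n + 1) :=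
  cotLift E (n + 1) (cotDComp E n)

lemma cotD_π (E : DoubleComplex A) (n i : ℤ) (j : ℕ) (h : i + j = n + 1) :
    cotD E n ≫ cotπ E (n + 1) i j h = cotDComp E n i j h := by
  simp [cotD]

lemma cotD_comp_cotD (E : DoubleComplex A) (n : ℤ) : cotD E n ≫ cotD E (n + 1) = 0 := by
  apply cot_hom_ext
  intro i j h
  have hs : (i - 1).negOnePow = - i.negOnePow := by rw [Int.negOnePow_sub]; simp
  rw [Category.assoc, cotD_π, zero_comp]
  rcases j with _ | _ | k
  · rw [cotDComp, ← Category.assoc, cotD_π, cotDComp]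
    simp
  · simp only [cotDComp, Preadditive.comp_add, Linear.comp_units_smul]
    rw [← Category.assoc, cotD_π, ← Category.assoc (cotD E n), cotD_π]
    simp [cotDComp, hs]
  · simp only [cotDComp, Preadditive.comp_add, Linear.comp_units_smul]
    rw [← Category.assoc, cotD_π, ← Category.assoc (cotD E n), cotD_π]
    have hd : (E.d k (k + 1)).f i ≫ (E.d (k + 1) (k + 1 + 1)).f i = 0 := by
      rw [← HomologicalComplex.comp_f, E.d_comp_d]; rfl
    simp [cotDComp, hs, hd, Preadditive.add_comp]

/-- The cototalization `Cot(E)` of a double complex: the product total complex. -/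
def cot (E : DoubleComplex A) : CochainComplex A ℤ :=
  CochainComplex.of (cotX E) (cotD E) (cotD_comp_cotD E)

/-- The component of `X^n ⟶ ∏_{i + j = n} E^{i,j}` at `(i, j)`: it is `ε` for `j = 0`, and it is
zero for `j > 0`. -/
def toCotComp {X : CochainComplex A ℤ} {E : DoubleComplex A} (ε : X ⟶ E.X 0) (n i : ℤ) :
    ∀ (j : ℕ), i + j = n → (X.X n ⟶ (E.X j).X i)
  | 0, h => (X.XIsoOfEq (by omega : n = i)).hom ≫ ε.f i
  | _ + 1, _ => 0

/-- The morphism `X ⟶ Cot(E)` induced by an augmentation `X ⟶ E^{•,0}`. -/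
def toCot {X : CochainComplex A ℤ} {E : DoubleComplex A} (ε : X ⟶ E.X 0)
    (hε : ε ≫ E.d 0 1 = 0) : X ⟶ cot E where
  f n := cotLift E n (toCotComp ε n)
  comm' := by
    rintro n _ rfl
    simp only [cot, CochainComplex.of_d]
    apply cot_hom_ext
    intro i j h
    rw [Category.assoc, Category.assoc, cotD_π, cotLift_π]
    rcases j with _ | _ | k
    · obtain rfl : i = n + 1 := by simpa using h
      rw [cotDComp, ← Category.assoc, cotLift_π]
      simp [toCotComp]
    · have h0 : ε.f i ≫ (E.d 0 1).f i = 0 := by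
        rw [← HomologicalComplex.comp_f, hε]; rfl
      simp only [cotDComp, Preadditive.comp_add, Linear.comp_units_smul]
      rw [← Category.assoc, cotLift_π, ← Category.assoc (cotLift _ _ _), cotLift_π]
      simp [toCotComp, h0]
    · simp only [cotDComp, Preadditive.comp_add, Linear.comp_units_smul]
      rw [← Category.assoc, cotLift_π, ← Category.assoc (cotLift _ _ _), cotLift_π]
      simp [toCotComp]

end Cototalization

section Resolutions

variable {A : Type u} [Category.{v} A] [Abelian A]

variable (A) in
/-- The functor sending a cochain complex `X` to its object of boundaries
`B^i(X) = im (d^{i-1} : X^{i-1} ⟶ X^i)`. -/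
def boundariesFunctor (i : ℤ) : CochainComplex A ℤ ⥤ A where
  obj X := image (X.d (i - 1) i)
  map {X Y} f := image.map (Arrow.homMk (f.f (i - 1)) (f.f i) (by simp) :
    Arrow.mk (X.d (i - 1) i) ⟶ Arrow.mk (Y.d (i - 1) i))
  map_id X := by
    rw [← cancel_mono (image.ι _)]
    exact (image.map_ι _).trans (by simp)
  map_comp {X Y Z} f g := by
    rw [← cancel_mono (image.ι _), Category.assoc]
    refine (image.map_ι _).trans ?_
    rw [image.map_ι]
    refine Eq.trans ?_ (Category.assoc _ _ _)
    rw [image.map_ι]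
    simp

instance (i : ℤ) : (boundariesFunctor A i).PreservesZeroMorphisms where
  map_zero X Y := by
    change image.map _ = 0
    refine (cancel_mono (image.ι (Y.d (i - 1) i))).1 ?_
    exact (image.map_ι _).trans (comp_zero.trans zero_comp.symm)

/-- The augmented complex `0 ⟶ Z ⟶ I⁰ ⟶ I¹ ⟶ ⋯` is an injective resolution of `Z`; this is the
condition on `(I, ε)` which is expressed by Mathlib's structure `InjectiveResolution Z`. -/
structure IsInjectiveResolution {Z : A} (I : CochainComplex A ℕ) (ε : Z ⟶ I.X 0) : Prop where
  injective (n : ℕ) : Injective (I.X n)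
  comp_d : ε ≫ I.d 0 1 = 0
  quasiIso : QuasiIso ((CochainComplex.fromSingle₀Equiv I Z).symm ⟨ε, comp_d⟩)

/-- Given a functor `G` (such as the `i`-th cohomology) from complexes to `A`, an augmented double
complex `X ⟶ E^{•,0} ⟶ E^{•,1} ⟶ ⋯` is sent by `G`, column by column, to an injective resolution
`0 ⟶ G(X) ⟶ G(E^{•,0}) ⟶ G(E^{•,1}) ⟶ ⋯` of `G(X)`. -/
def ResolvesUnder (G : CochainComplex A ℤ ⥤ A) [G.PreservesZeroMorphisms]
    {X : CochainComplex A ℤ} (E : DoubleComplex A) (ε : X ⟶ E.X 0) : Prop :=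
  IsInjectiveResolution (Z := G.obj X) ((G.mapHomologicalComplex (ComplexShape.up ℕ)).obj E)
    (G.map ε)

/-- A Cartan–Eilenberg injective resolution of a complex `X`: an augmented double complex such that
the rows and the induced sequences of boundaries, of cocycles and of cohomology objects of the
columns are injective resolutions of `X^i`, `B^i(X)`, `Z^i(X)` and `H^i(X)`. -/
structure CEInjectiveResolution (X : CochainComplex A ℤ) where
  E : DoubleComplex A
  ε : X ⟶ E.X 0
  ε_comp_d : ε ≫ E.d 0 1 = 0
  resolves_cohomology (i : ℤ) :
    ResolvesUnder (HomologicalComplex.homologyFunctor A (ComplexShape.up ℤ) i) E ε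
  resolves_boundaries (i : ℤ) : ResolvesUnder (boundariesFunctor A i) E ε
  resolves_cocycles (i : ℤ) :
    ResolvesUnder (HomologicalComplex.cyclesFunctor A (ComplexShape.up ℤ) i) E ε
  resolves_objects (i : ℤ) :
    ResolvesUnder (HomologicalComplex.eval A (ComplexShape.up ℤ) i) E ε

/-! ### Homotopically injective complexes -/

variable (A) in
/-- The homotopically injective complexes, as objects of the homotopy category `K(A)`: those `X`
such that every morphism `N ⟶ X` in `K(A)` with `N` acyclic is zero. -/
abbrev homotopicallyInjective : ObjectProperty (HomotopyCategory A (ComplexShape.up ℤ)) :=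
  (HomotopyCategory.subcategoryAcyclic A).rightOrthogonal

variable (A) in
/-- The full triangulated subcategory `K_inj(A)` of `K(A)`. -/
abbrev KInj := (homotopicallyInjective A).FullSubcategory

/-- A morphism in `K(A)` is a homotopically injective resolution if it is a quasi-isomorphism to
a homotopically injective complex. -/
def IsHomotopicallyInjectiveResolution {X E : HomotopyCategory A (ComplexShape.up ℤ)}
    (f : X ⟶ E) : Prop :=
  HomotopyCategory.quasiIso A (ComplexShape.up ℤ) f ∧ homotopicallyInjective A E

variable (A) in
/-- For every complex `X` and every Cartan–Eilenberg injective resolution `X ⟶ E`, the map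
`X ⟶ Cot(E)` is a homotopically injective resolution. -/
def CotCEIsHomotopicallyInjectiveResolution [HasLimits A] : Prop :=
  ∀ (X : CochainComplex A ℤ) (R : CEInjectiveResolution X),
    IsHomotopicallyInjectiveResolution
      ((HomotopyCategory.quotient A (ComplexShape.up ℤ)).map (toCot R.ε R.ε_comp_d))

lemma homotopicallyInjective_single (Q : A) [Injective Q] :
    homotopicallyInjective A ((HomotopyCategory.quotient A (ComplexShape.up ℤ)).obj
      ((CochainComplex.singleFunctor A 0).obj Q)) := by
  refine (CochainComplex.isKInjective_iff_rightOrthogonal _).1 ?_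
  have : ∀ n : ℤ, Injective (((CochainComplex.singleFunctor A 0).obj Q).X n) := by
    intro n
    by_cases h : n = 0
    · subst h
      exact Injective.of_iso (HomologicalComplex.singleObjXSelf (ComplexShape.up ℤ) 0 Q).symm
        inferInstance
    · exact Injective.of_iso
        ((HomologicalComplex.isZero_single_obj_X (ComplexShape.up ℤ) 0 Q n h).isoZero).symm
        inferInstance
  exact CochainComplex.isKInjective_of_injective _ 0

/-- An injective object `Q`, seen as a complex concentrated in degree zero, as an object
of `K_inj(A)`. -/
def injObj (Q : A) [Injective Q] : KInj A where
  obj := (HomotopyCategory.quotient A (ComplexShape.up ℤ)).obj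
    ((CochainComplex.singleFunctor A 0).obj Q)
  property := homotopicallyInjective_single Q

/-- The set `{Q[n] | n ∈ ℤ}` of objects of `K_inj(A)`. -/
def shiftsOf (Q : A) [Injective Q] : ObjectProperty (KInj A) :=
  ObjectProperty.ofObj fun n : ℤ => (injObj Q)⟦n⟧

end Resolutions

/-! ### Homotopy limits, cofiltered objects, Brown representability -/

section Triangulated

variable {T : Type u} [Category.{v} T]

/-- `Prod(S)`: the direct factors of (small) products of objects in `S`. -/
def IsProdFactor (S : ObjectProperty T) (X : T) : Prop :=
  ∃ (J : Type v) (Y : J → T) (c : Fan Y), (∀ j, S (Y j)) ∧ Nonempty (IsLimit c) ∧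
    Nonempty (Retract X c.pt)

variable [HasZeroObject T] [HasShift T ℤ] [Preadditive T]
  [∀ n : ℤ, (shiftFunctor T n).Additive] [Pretriangulated T]

/-- `X` is a homotopy limit of the tower `⋯ ⟶ Y₂ ⟶ Y₁ ⟶ Y₀`: there is a distinguished triangle
`X ⟶ ∏ Yₙ ⟶ ∏ Yₙ ⟶ X[1]` whose middle map is `1 - shift`. -/
def IsHomotopyLimit (Y : ℕ → T) (φ : ∀ n, Y (n + 1) ⟶ Y n) (X : T) : Prop :=
  ∃ (c : Fan Y) (hc : IsLimit c) (a : X ⟶ c.pt) (b : c.pt ⟶ X⟦(1 : ℤ)⟧),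
    Triangle.mk a (𝟙 c.pt - Fan.IsLimit.lift hc (fun n => c.proj (n + 1) ≫ φ n)) b ∈ distTriang T

/-- `X` is `S`-cofiltered: it is a homotopy limit of a tower `⋯ ⟶ Y₂ ⟶ Y₁ ⟶ Y₀` with
`Y₀ ∈ Prod(S)` and with distinguished triangles `Pₙ ⟶ Yₙ₊₁ ⟶ Yₙ ⟶ Pₙ[1]`, `Pₙ ∈ Prod(S)`. -/
def IsCofilteredBy (S : ObjectProperty T) (X : T) : Prop :=
  ∃ (Y : ℕ → T) (φ : ∀ n, Y (n + 1) ⟶ Y n), IsHomotopyLimit Y φ X ∧ IsProdFactor S (Y 0) ∧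
    ∀ n, ∃ (P : T) (a : P ⟶ Y (n + 1)) (b : Y n ⟶ P⟦(1 : ℤ)⟧),
      IsProdFactor S P ∧ Triangle.mk a (φ n) b ∈ distTriang T

end Triangulated

/-- `Tᵒᵖ` satisfies Brown representability, relatively to the universe `w` of small sets: every
homological functor from `T` to the category of (small) abelian groups which preserves (small)
products is isomorphic to `Hom(X, -)`, as a functor to abelian groups, for some object `X`.
(The hom-sets of `T` are not assumed to be small, hence the comparison takes place in a universe
containing both the small abelian groups and the groups `Hom(X, Y)`.) -/
def OpSatisfiesBrownRepresentability (T : Type u) [Category.{v} T] [HasZeroObject T]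
    [HasShift T ℤ] [Preadditive T] [∀ n : ℤ, (shiftFunctor T n).Additive]
    [Pretriangulated T] : Prop :=
  ∀ (F : T ⥤ AddCommGrpCat.{w}), F.IsHomological →
    (∀ J : Type w, PreservesLimitsOfShape (Discrete J) F) →
    ∃ X : T, Nonempty (F ⋙ AddCommGrpCat.uliftFunctor.{v, w} ≅
      preadditiveCoyoneda.obj (Opposite.op X) ⋙ AddCommGrpCat.uliftFunctor.{w, v})

/-! ### Total right derived functors -/

section RightDerived

variable {A : Type u} [Category.{v} A] [Abelian A] [HasDerivedCategory A]
  {B : Type u'} [Category.{v'} B] [Abelian B] [HasDerivedCategory B]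

/-- `F` has a total right derived functor: a triangulated functor `RF : D(A) ⥤ D(B)` equipped
with a natural transformation of triangulated functors from `K(A) ⥤ K(B) ⥤ D(B)` to
`K(A) ⥤ D(A) ⥤ D(B)` which is universal, i.e. which makes `RF` a left Kan extension. -/
def HasTotalRightDerivedFunctor (F : A ⥤ B) [F.Additive] : Prop :=
  ∃ (RF : DerivedCategory A ⥤ DerivedCategory B) (_ : RF.CommShift ℤ)
    (α : F.mapHomotopyCategory (ComplexShape.up ℤ) ⋙ DerivedCategory.Qh ⟶
      DerivedCategory.Qh ⋙ RF),
    RF.IsTriangulated ∧ NatTrans.CommShift α ℤ ∧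
      RF.IsRightDerivedFunctor α (HomotopyCategory.quasiIso A (ComplexShape.up ℤ))

end RightDerived

end CartanEilenberg

end

/-! The crux is that Cartan–Eilenberg resolutions exist whose columns are trivial up to homotopy.
Every complex `X` embeds, injectively on cohomology, in a complex of injectives `ceUnder X` that
deformation retracts onto a complex with zero differential. Iterating on the cokernels gives short
exact sequences which stay exact on cohomology, cocycles and boundaries, and which splice to a
resolution (`exists_ceInjectiveResolution`). The hypothesis on `Cot` then gives (1). Since `K(A)(X,
E) → D(A)(X, E)` is bijective for `E` homotopically injective, (2) follows and `Qh` has a right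
adjoint; composition with that adjoint computes left Kan extensions along `Qh`, which is (3).

For (5), the total complexes of the columns `0, …, k` form a tower of degreewise split epimorphisms
with limit `Cot(E)`, whose successive kernels are the reindexed columns. A column is homotopy
equivalent to a product of injectives placed in single degrees, hence is a direct factor of a
product of shifts of `Q` (`CESplitting.isProdFactor`). For a split tower, `1 - shift` is a split
epimorphism with kernel the limit (`exists_splitting_of_tower`), so `Cot(E)` is the homotopy limit.
Every homotopically injective complex is isomorphic in `K_inj(A)` to such a `Cot(E)`.

For (4), universal elements are constructed in `K_inj(A)`, using (5) and the products inherited from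
`D(A)`. An element reaching all elements on the shifts of `Q` is lifted along a tower of fibres,
each step annihilating the morphisms to shifts of `Q` that kill the current element. On the homotopy
limit of this tower there is an element reaching every element on every cofiltered object
(`exists_weakly_initial`). Splitting an idempotent then makes it universal
(`exists_universal_element`). -/

noncomputable section

set_option linter.unusedSectionVars false

namespace CartanEilenberg

/-! ### Splitting of idempotents in triangulated categories with countable products. -/

section Idempotents

variable {T : Type u} [Category.{v} T] [HasZeroObject T] [HasShift T ℤ] [Preadditive T]
  [∀ n : ℤ, (shiftFunctor T n).Additive] [Pretriangulated T]

/-- In a triangulated category, a split monomorphism `f`, with retraction `g`, has a complement. -/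
lemma exists_complement_of_comp_eq_id {V V' : T} (f : V ⟶ V') (g : V' ⟶ V) (hfg : f ≫ g = 𝟙 V) :
    ∃ (C : T) (c : V' ⟶ C) (i : C ⟶ V'), i ≫ c = 𝟙 C ∧ c ≫ i = 𝟙 V' - g ≫ f := by
  obtain ⟨C, c, h, hT⟩ := distinguished_cocone_triangle f
  have hfc : f ≫ c = 0 := comp_distTriang_mor_zero₁₂ _ hT
  have hh : h = 0 := by
    have h31 : h ≫ f⟦(1 : ℤ)⟧' = 0 := comp_distTriang_mor_zero₃₁ _ hT
    have : h ≫ f⟦(1 : ℤ)⟧' ≫ g⟦(1 : ℤ)⟧' = 0 := by rw [reassoc_of% h31, zero_comp]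
    rwa [← Functor.map_comp, hfg, CategoryTheory.Functor.map_id, Category.comp_id] at this
  have hc : Epi c := (Triangle.mor₃_eq_zero_iff_epi₂ _ hT).1 hh
  obtain ⟨i, hi⟩ := Triangle.yoneda_exact₂ _ hT (𝟙 V' - g ≫ f)
    (show f ≫ (𝟙 V' - g ≫ f) = 0 by simp [reassoc_of% hfg])
  change V' ⟶ C at c
  change C ⟶ V' at i
  change 𝟙 V' - g ≫ f = c ≫ i at hi
  refine ⟨C, c, i, ?_, hi.symm⟩
  rw [← cancel_epi c, ← Category.assoc, ← hi, Preadditive.sub_comp, Category.assoc, hfc]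
  simp

/-- Idempotents split in triangulated categories with countable products. -/
lemma exists_splitting_of_idem [HasProductsOfShape ℕ T] {W : T} (e : W ⟶ W) (he : e ≫ e = e) :
    ∃ (U : T) (p : W ⟶ U) (i : U ⟶ W), p ≫ i = e ∧ i ≫ p = 𝟙 U := by
  let V := ∏ᶜ fun _ : ℕ => W
  let π (n : ℕ) : V ⟶ W := Pi.π (fun _ : ℕ => W) n
  -- Think of `W` as an `e`-part plus a `(1 - e)`-part: `f` moves the `e`-parts one place up and
  -- fixes the rest, `g` moves them back. The complement of `f` is then the `e`-part in position 0,
  -- which is the image of `e`.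
  let f : V ⟶ V := Pi.lift fun n => match n with
    | 0 => π 0 ≫ (𝟙 W - e)
    | n + 1 => π (n + 1) ≫ (𝟙 W - e) + π n ≫ e
  let g : V ⟶ V := Pi.lift fun n => π n ≫ (𝟙 W - e) + π (n + 1) ≫ e
  let a : W ⟶ V := Pi.lift fun n => match n with
    | 0 => 𝟙 W
    | _ + 1 => 0
  have f0 : f ≫ π 0 = π 0 ≫ (𝟙 W - e) := Pi.lift_π _ _
  have fs (n : ℕ) : f ≫ π (n + 1) = π (n + 1) ≫ (𝟙 W - e) + π n ≫ e := Pi.lift_π _ _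
  have gn (n : ℕ) : g ≫ π n = π n ≫ (𝟙 W - e) + π (n + 1) ≫ e := Pi.lift_π _ _
  have a0 : a ≫ π 0 = 𝟙 W := Pi.lift_π _ _
  have as (n : ℕ) : a ≫ π (n + 1) = 0 := Pi.lift_π _ _
  have h1 : (𝟙 W - e) ≫ (𝟙 W - e) = 𝟙 W - e := by simp [he]
  have h2 : (𝟙 W - e) ≫ e = 0 := by simp [he]
  have h3 : e ≫ (𝟙 W - e) = 0 := by simp [he]
  have hfg : f ≫ g = 𝟙 V := by
    refine Pi.hom_ext _ _ fun n => ?_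
    change (f ≫ g) ≫ π n = 𝟙 V ≫ π n
    rw [Category.assoc, gn, Preadditive.comp_add, ← Category.assoc, ← Category.assoc, fs]
    rcases n with _ | n
    · rw [f0]
      simp only [Preadditive.add_comp, Category.assoc, h1, h2, he]
      simp
    · rw [fs]
      simp only [Preadditive.add_comp, Category.assoc, h1, h2, h3, he]
      simp
  have hgf : 𝟙 V - g ≫ f = π 0 ≫ e ≫ a := by
    refine Pi.hom_ext _ _ fun n => ?_
    change (𝟙 V - g ≫ f) ≫ π n = (π 0 ≫ e ≫ a) ≫ π n
    rw [Preadditive.sub_comp, Category.assoc, Category.assoc, Category.assoc]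
    rcases n with _ | n
    · rw [f0, a0, ← Category.assoc g, gn]
      simp only [Preadditive.add_comp, Category.assoc, h1, h3]
      simp
    · rw [fs, as, Preadditive.comp_add, ← Category.assoc, ← Category.assoc g, gn, gn]
      simp only [Preadditive.add_comp, Category.assoc, h1, h2, h3, he]
      simp
  obtain ⟨C, c, i, hic, hci⟩ := exists_complement_of_comp_eq_id f g hfg
  rw [hgf] at hci
  have hi : i ≫ π 0 ≫ a = i := by
    have : i = i ≫ π 0 ≫ e ≫ a := by rw [← hci, reassoc_of% hic]
    rw [this]
    simp only [Category.assoc]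
    rw [reassoc_of% a0]
  refine ⟨C, a ≫ c, i ≫ π 0, ?_, ?_⟩
  · rw [Category.assoc, reassoc_of% hci, a0, Category.comp_id, reassoc_of% a0]
  · have : i ≫ π 0 ≫ a ≫ c = (i ≫ π 0 ≫ a) ≫ c := by simp
    rw [Category.assoc, this, hi, hic]

end Idempotents

/-! ### Elements of product-preserving homological functors. -/

section Elements

variable {T : Type u} [Category.{v} T] (H : T ⥤ AddCommGrpCat.{w})

/-- Elements of the value of a functor to abelian groups at a product, when the functor preserves
this product. -/
lemma exists_element_of_isLimit {J : Type*} [PreservesLimitsOfShape (Discrete J) H]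
    {Y : J → T} {c : Fan Y} (hc : IsLimit c) (y : ∀ j, H.obj (Y j)) :
    ∃ x : H.obj c.pt, ∀ j, H.map (c.proj j) x = y j := by
  let h := isLimitOfPreserves H hc
  -- Elements are morphisms from the free group on one generator, so the universal property of the
  -- limit applies to them.
  let z (j : J) : AddCommGrpCat.of (ULift.{w} ℤ) ⟶ H.obj (Y j) :=
    AddCommGrpCat.ofHom ((zmultiplesHom (H.obj (Y j)) (y j)).comp AddEquiv.ulift.toAddMonoidHom)
  let k := h.lift (Cone.mk _ (Discrete.natTrans fun j => z j.as))
  refine ⟨k ⟨1⟩, fun j => ?_⟩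
  have h1 : k ≫ H.map (c.proj j) = z j := h.fac _ ⟨j⟩
  have h2 := ConcreteCategory.congr_hom h1 ⟨1⟩
  rw [ConcreteCategory.comp_apply] at h2
  rw [h2]
  exact one_zsmul (y j)

lemma element_ext_of_isLimit {J : Type*} [PreservesLimitsOfShape (Discrete J) H]
    {Y : J → T} {c : Fan Y} (hc : IsLimit c) {x x' : H.obj c.pt}
    (hx : ∀ j, H.map (c.proj j) x = H.map (c.proj j) x') : x = x' := by
  let h := isLimitOfPreserves H hc
  let z (x : H.obj c.pt) : AddCommGrpCat.of (ULift.{w} ℤ) ⟶ H.obj c.pt :=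
    AddCommGrpCat.ofHom ((zmultiplesHom (H.obj c.pt) x).comp AddEquiv.ulift.toAddMonoidHom)
  have hz : z x = z x' := by
    refine h.hom_ext fun ⟨j⟩ => ?_
    ext ⟨n⟩
    change H.map (c.proj j) (n • x) = H.map (c.proj j) (n • x')
    rw [map_zsmul, map_zsmul, hx]
  have h1 : (1 : ℤ) • x = (1 : ℤ) • x' := ConcreteCategory.congr_hom hz ⟨1⟩
  rwa [one_zsmul, one_zsmul] at h1

/-- The element `w ∈ H(W)` covers `X` if every element of `H(X)` is the image of `w` by a
morphism `W ⟶ X`. -/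
def Covers {W : T} (w : H.obj W) (X : T) : Prop :=
  ∀ x : H.obj X, ∃ f : W ⟶ X, H.map f w = x

variable {H}

lemma map_comp_element {X Y Z : T} (f : X ⟶ Y) (g : Y ⟶ Z) (x : H.obj X) :
    H.map (f ≫ g) x = H.map g (H.map f x) := by
  rw [H.map_comp, ConcreteCategory.comp_apply]

lemma Covers.of_hom {W W' : T} {w : H.obj W} {X : T} (h : Covers H w X) (p : W' ⟶ W)
    {w' : H.obj W'} (hp : H.map p w' = w) : Covers H w' X := fun x => by
  obtain ⟨f, rfl⟩ := h x
  exact ⟨p ≫ f, by rw [map_comp_element, hp]⟩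

lemma Covers.of_retract {W : T} {w : H.obj W} {X Y : T} (h : Covers H w Y) (r : Retract X Y) :
    Covers H w X := fun x => by
  obtain ⟨f, hf⟩ := h (H.map r.i x)
  exact ⟨f ≫ r.r, by rw [map_comp_element, hf, ← map_comp_element, r.retract]; simp⟩

lemma Covers.of_isLimit {J : Type*} [PreservesLimitsOfShape (Discrete J) H]
    {W : T} {w : H.obj W} {Y : J → T} {c : Fan Y} (hc : IsLimit c) (h : ∀ j, Covers H w (Y j)) :
    Covers H w c.pt := fun x => by
  choose f hf using fun j => h j (H.map (c.proj j) x)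
  refine ⟨Fan.IsLimit.lift hc f, element_ext_of_isLimit H hc fun j => ?_⟩
  rw [← map_comp_element, Fan.IsLimit.fac, hf]

variable [Preadditive T]

/-- The morphism `p : W' ⟶ W` annihilates the morphisms `W ⟶ X` which annihilate `w`. -/
def Annihilates {W W' : T} (p : W' ⟶ W) (w : H.obj W) (X : T) : Prop :=
  ∀ f : W ⟶ X, H.map f w = 0 → p ≫ f = 0

lemma Annihilates.of_retract {W W' : T} {p : W' ⟶ W} {w : H.obj W} {X Y : T}
    (h : Annihilates p w Y) (r : Retract X Y) : Annihilates p w X := fun f hf => by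
  have := h (f ≫ r.i) (by rw [map_comp_element, hf, map_zero])
  rw [← Category.comp_id f, ← r.retract, ← Category.assoc, ← Category.assoc, Category.assoc p, this,
    zero_comp]

lemma Annihilates.of_isLimit {J : Type*} {W W' : T} {p : W' ⟶ W} {w : H.obj W}
    {Y : J → T} {c : Fan Y} (hc : IsLimit c) (h : ∀ j, Annihilates p w (Y j)) :
    Annihilates p w c.pt := fun f hf => Fan.IsLimit.hom_ext hc _ _ fun j => by
  rw [Category.assoc, h j _ (by rw [map_comp_element, hf, map_zero]), zero_comp]

variable [HasZeroObject T] [HasShift T ℤ] [∀ n : ℤ, (shiftFunctor T n).Additive]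

/-- A property which is stable under products and retracts holds for the shifts of the objects
of `Prod(S)` if it holds for the shifts of the objects of `S`. -/
lemma IsProdFactor.shift_induction {S : ObjectProperty T} (Z : T → Prop)
    (hZr : ∀ {X Y : T}, Retract X Y → Z Y → Z X)
    (hZp : ∀ {J : Type v} {Y : J → T} {c : Fan Y}, IsLimit c → (∀ j, Z (Y j)) → Z c.pt)
    (n : ℤ) (hS : ∀ Y, S Y → Z (Y⟦n⟧)) {X : T} (hX : IsProdFactor S X) : Z (X⟦n⟧) := by
  obtain ⟨J, Y, c, hY, ⟨hc⟩, ⟨r⟩⟩ := hX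
  refine hZr (r.map (shiftFunctor T n)) ?_
  have hc' : IsLimit (Fan.mk (c.pt⟦n⟧) fun j => (c.proj j)⟦n⟧') :=
    isLimitMapConeFanMkEquiv (shiftFunctor T n) Y c.proj
      (isLimitOfPreserves _ (IsLimit.ofIsoLimit hc (Cone.ext (Iso.refl _))))
  exact hZp hc' fun j => hS _ (hY j)

variable [Pretriangulated T]

lemma exists_element_of_distTriang [H.IsHomological] {X Y Z : T} {f : X ⟶ Y} {g : Y ⟶ Z}
    {h : Z ⟶ X⟦(1 : ℤ)⟧} (hT : Triangle.mk f g h ∈ distTriang T) (y : H.obj Y)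
    (hy : H.map g y = 0) : ∃ x : H.obj X, H.map f x = y :=
  (ShortComplex.ab_exact_iff _).1 (H.map_distinguished_exact _ hT) y hy

lemma map_sub_element [H.Additive] {X Y : T} (f g : X ⟶ Y) (x : H.obj X) :
    H.map (f - g) x = H.map f x - H.map g x := by
  rw [H.map_sub]; rfl

lemma map_add_element [H.Additive] {X Y : T} (f g : X ⟶ Y) (x : H.obj X) :
    H.map (f + g) x = H.map f x + H.map g x := by
  rw [H.map_add]; rfl

/-- Morphisms `W ⟶ X` sending `w` to the image of `x'` can be lifted along `φ : X' ⟶ X` after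
precomposition with `p : W' ⟶ W`, in such a way that `w'` is sent to `x'`. -/
lemma exists_lift_of_distTriang [H.IsHomological] {P X' X W W' : T} {a : P ⟶ X'} {φ : X' ⟶ X}
    {b : X ⟶ P⟦(1 : ℤ)⟧} (hT : Triangle.mk a φ b ∈ distTriang T) {w : H.obj W} {w' : H.obj W'}
    (p : W' ⟶ W) (hp : H.map p w' = w) (hcov : Covers H w' P)
    (hann : Annihilates p w (P⟦(1 : ℤ)⟧)) (f : W ⟶ X) (x' : H.obj X')
    (hf : H.map f w = H.map φ x') : ∃ f' : W' ⟶ X', f' ≫ φ = p ≫ f ∧ H.map f' w' = x' := by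
  -- The obstruction `f ≫ b` to lifting `f` kills `w`, because the image of `w` under `f` comes from
  -- `X'`; hence `p` annihilates it.
  have h0 : p ≫ f ≫ b = 0 := hann _ (by
    rw [map_comp_element, hf, ← map_comp_element,
      show φ ≫ b = 0 from comp_distTriang_mor_zero₂₃ _ hT, H.map_zero]; rfl)
  obtain ⟨f₀, hf₀⟩ : ∃ f₀ : W' ⟶ X', p ≫ f = f₀ ≫ φ :=
    Triangle.coyoneda_exact₃ _ hT (p ≫ f) ((Category.assoc _ _ _).trans h0)
  -- The lift `f₀` may miss `x'` by an element coming from `H(P)`; as `w'` covers `P`, a morphism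
  -- through `a` corrects it.
  obtain ⟨z, hz⟩ := exists_element_of_distTriang (H := H) hT (x' - H.map f₀ w') (by
    rw [map_sub, ← map_comp_element, ← hf₀, map_comp_element, hp, hf, sub_self])
  obtain ⟨k, hk⟩ := hcov z
  refine ⟨f₀ + k ≫ a, ?_, ?_⟩
  · rw [Preadditive.add_comp, ← hf₀, Category.assoc,
      show a ≫ φ = 0 from comp_distTriang_mor_zero₁₂ _ hT, comp_zero, add_zero]
  · rw [map_add_element, map_comp_element, hk, hz, add_sub_cancel]

lemma covers_of_distTriang [H.IsHomological] {P X' X W W' : T} {a : P ⟶ X'} {φ : X' ⟶ X}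
    {b : X ⟶ P⟦(1 : ℤ)⟧} (hT : Triangle.mk a φ b ∈ distTriang T) {w : H.obj W} {w' : H.obj W'}
    (p : W' ⟶ W) (hp : H.map p w' = w) (hcov : Covers H w' P)
    (hann : Annihilates p w (P⟦(1 : ℤ)⟧)) (hX : Covers H w X) : Covers H w' X' := fun x' => by
  obtain ⟨f, hf⟩ := hX (H.map φ x')
  obtain ⟨f', -, hf'⟩ := exists_lift_of_distTriang hT p hp hcov hann f x' hf
  exact ⟨f', hf'⟩

end Elements

/-! ### The two elementary constructions: reaching elements and annihilating morphisms. -/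

section

variable {T : Type u} [Category.{v} T] [HasZeroObject T] [HasShift T ℤ] [Preadditive T]
  [∀ n : ℤ, (shiftFunctor T n).Additive] [Pretriangulated T] [HasProducts.{v} T]
  {H : T ⥤ AddCommGrpCat.{v}} [H.IsHomological]
  (hH : ∀ J : Type v, PreservesLimitsOfShape (Discrete J) H)

-- The product of one copy of `G i` for each element of `H(G i)` carries the family of all these
-- elements, and the projections recover them.
include hH in
lemma exists_covers {ι : Type} (G : ι → T) :
    ∃ (W : T) (w : H.obj W), ∀ i, Covers H w (G i) := by
  obtain ⟨w, hw⟩ := exists_element_of_isLimit H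
    (productIsProduct fun k : Σ i, H.obj (G i) => G k.1) fun k => k.2
  exact ⟨_, w, fun i x => ⟨_, hw ⟨i, x⟩⟩⟩

-- `W'` is the fibre of the map from `W` to the product of the targets of all morphisms killing `w`.
-- This map kills `w`, so `w` lifts to the fibre.
include hH in
lemma exists_annihilates {ι : Type} (G : ι → T) {W : T} (w : H.obj W) :
    ∃ (W' : T) (w' : H.obj W') (p : W' ⟶ W), H.map p w' = w ∧ ∀ i, Annihilates p w (G i) := by
  let K := Σ i, {f : W ⟶ G i // H.map f w = 0}
  let φ : W ⟶ ∏ᶜ fun k : K => G k.1 := Pi.lift fun k => k.2.1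
  have hφ (k : K) : φ ≫ Pi.π (fun k : K => G k.1) k = k.2.1 := Pi.lift_π _ _
  obtain ⟨W', p, b, hT⟩ := distinguished_cocone_triangle₁ φ
  obtain ⟨w', hw'⟩ := exists_element_of_distTriang hT w (by
    refine element_ext_of_isLimit H (productIsProduct fun k : K => G k.1) fun k => ?_
    rw [← map_comp_element, map_zero]
    exact (congrArg (fun f => H.map f w) (hφ k)).trans k.2.2)
  refine ⟨W', w', p, hw', fun i f hf => ?_⟩
  have h0 : p ≫ φ = 0 := comp_distTriang_mor_zero₁₂ _ hT
  have h1 : φ ≫ Pi.π (fun k : K => G k.1) ⟨i, f, hf⟩ = f := hφ _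
  rw [← h1, reassoc_of% h0, zero_comp]

end

/-! ### Brown representability from cofiltrations. -/

section Brown

variable {T : Type u} [Category.{v} T] [HasZeroObject T] [HasShift T ℤ] [Preadditive T]
  [∀ n : ℤ, (shiftFunctor T n).Additive] [Pretriangulated T] [HasProducts.{v} T]
  {H : T ⥤ AddCommGrpCat.{v}} [H.IsHomological]
  (hH : ∀ J : Type v, PreservesLimitsOfShape (Discrete J) H)

include hH in
/-- The tower whose homotopy limit carries a weakly initial element of `H`. -/
lemma exists_annihilating_tower {ι : Type} (G : ι → T) :
    ∃ (W : ℕ → T) (w : ∀ n, H.obj (W n)) (p : ∀ n, W (n + 1) ⟶ W n),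
      (∀ i, Covers H (w 0) (G i)) ∧ (∀ n, H.map (p n) (w (n + 1)) = w n) ∧
        ∀ n i, Annihilates (p n) (w n) (G i) := by
  obtain ⟨W₀, w₀, h₀⟩ := exists_covers hH G
  have step (A : Σ W : T, H.obj W) : ∃ (B : Σ W : T, H.obj W) (p : B.1 ⟶ A.1),
      H.map p B.2 = A.2 ∧ ∀ i, Annihilates p A.2 (G i) := by
    obtain ⟨W', w', p, hp⟩ := exists_annihilates hH G A.2
    exact ⟨⟨W', w'⟩, p, hp⟩
  choose B p hp hB using step
  let V (n : ℕ) : Σ W : T, H.obj W := Nat.rec ⟨W₀, w₀⟩ (fun _ A => B A) n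
  exact ⟨fun n => (V n).1, fun n => (V n).2, fun n => p (V n), h₀, fun n => hp (V n),
    fun n => hB (V n)⟩

include hH in
/-- If all the objects of `T` are cofiltered by a set of objects, then any product preserving
homological functor to abelian groups has a weakly initial element. -/
lemma exists_weakly_initial {ι : Type} (G : ι → T)
    (hG : ∀ X : T, IsCofilteredBy (ObjectProperty.ofObj G) X) :
    ∃ (W : T) (w : H.obj W), ∀ X, Covers H w X := by
  have : PreservesLimitsOfShape (Discrete ℕ) H :=
    preservesLimitsOfShape_of_equiv (Discrete.equivalence (Equiv.ulift.{v})) H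
  have : HasProductsOfShape ℕ T :=
    hasLimitsOfShape_of_equivalence (Discrete.equivalence (Equiv.ulift.{v}))
  obtain ⟨W, w, p, h₀, hp, hW⟩ := exists_annihilating_tower (H := H) hH
    (fun k : ι × ℤ => (G k.1)⟦k.2⟧)
  have hw₀ (n : ℕ) {X : T} (hX : Covers H (w 0) X) : Covers H (w n) X := by
    induction n with
    | zero => exact hX
    | succ n hn => exact hn.of_hom (p n) (hp n)
  have hcov (n : ℕ) (k : ℤ) {P : T} (hP : IsProdFactor (ObjectProperty.ofObj G) P) :
      Covers H (w n) (P⟦k⟧) :=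
    hP.shift_induction (Covers H (w n)) (fun r h => h.of_retract r)
      (fun hc h => by have := hH; exact Covers.of_isLimit hc h) k
      (by rintro _ ⟨i⟩; exact hw₀ n (h₀ ⟨i, k⟩))
  have hann (n : ℕ) (k : ℤ) {P : T} (hP : IsProdFactor (ObjectProperty.ofObj G) P) :
      Annihilates (p n) (w n) (P⟦k⟧) :=
    hP.shift_induction (Annihilates (p n) (w n)) (fun r h => h.of_retract r)
      (fun hc h => Annihilates.of_isLimit hc h) k (by rintro _ ⟨i⟩; exact hW n ⟨i, k⟩)
  obtain ⟨W', a, b, hT⟩ := distinguished_cocone_triangle₁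
    (𝟙 (∏ᶜ W) - Pi.lift fun n => Pi.π W (n + 1) ≫ p n)
  have ha (n : ℕ) : a ≫ Pi.π W (n + 1) ≫ p n = a ≫ Pi.π W n := by
    have h0 : a ≫ (𝟙 (∏ᶜ W) - Pi.lift fun n => Pi.π W (n + 1) ≫ p n) = 0 :=
      comp_distTriang_mor_zero₁₂ _ hT
    have := congrArg (fun f => f ≫ Pi.π W n) h0
    simp only [Preadditive.comp_sub, Preadditive.sub_comp, Category.assoc, Category.comp_id,
      zero_comp, limit.lift_π, Fan.mk_pt, Fan.mk_π_app] at this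
    exact (sub_eq_zero.1 this).symm
  -- The family of the `w n` is compatible with the tower, hence is killed by `1 - shift` and lifts
  -- to the homotopy limit `W'`.
  obtain ⟨w₁, hw₁⟩ := exists_element_of_isLimit H (productIsProduct W) w
  obtain ⟨w', hw'⟩ := exists_element_of_distTriang hT w₁ (by
    refine element_ext_of_isLimit H (productIsProduct W) fun n => ?_
    rw [map_zero, ← map_comp_element]
    change H.map ((𝟙 (∏ᶜ W) - Pi.lift fun n => Pi.π W (n + 1) ≫ p n) ≫ Pi.π W n) w₁ = 0
    rw [Preadditive.sub_comp, Category.id_comp, Pi.lift_π, map_sub_element, map_comp_element,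
      sub_eq_zero]
    exact (hw₁ n).trans (((congrArg (H.map (p n)) (hw₁ (n + 1))).trans (hp n)).symm))
  have hw'n (n : ℕ) : H.map (a ≫ Pi.π W n) w' = w n := by
    rw [map_comp_element, hw']; exact hw₁ n
  refine ⟨W', w', fun X x => ?_⟩
  obtain ⟨Y, φ, ⟨c, hc, α, β, hT'⟩, hY₀, hY⟩ := hG X
  -- All shifts are needed: `k = 0` starts the family of morphisms `W n ⟶ Y n`, and `k = -1` handles
  -- the `lim¹` correction at the end.
  have hcovY (n : ℕ) (k : ℤ) : Covers H (w n) ((Y n)⟦k⟧) := by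
    induction n with
    | zero => exact hcov 0 k hY₀
    | succ n hn =>
      obtain ⟨P, u, v, hP, hT''⟩ := hY n
      exact covers_of_distTriang (Triangle.shift_distinguished _ hT'' k) (p n) (hp n)
        (hcov (n + 1) k hP)
        ((hann n (k + 1) hP).of_retract (Retract.ofIso ((shiftFunctorAdd T k 1).symm.app P))) hn
  have hα (n : ℕ) : α ≫ c.proj (n + 1) ≫ φ n = α ≫ c.proj n := by
    have h0 : α ≫ (𝟙 c.pt - Fan.IsLimit.lift hc (fun n => c.proj (n + 1) ≫ φ n)) = 0 :=
      comp_distTriang_mor_zero₁₂ _ hT'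
    have := congrArg (fun f => f ≫ c.proj n) h0
    simp only [Preadditive.comp_sub, Preadditive.sub_comp, Category.assoc, Category.comp_id,
      zero_comp, Fan.IsLimit.fac] at this
    exact (sub_eq_zero.1 this).symm
  let x' (n : ℕ) : H.obj (Y n) := H.map (α ≫ c.proj n) x
  have hx' (n : ℕ) : H.map (φ n) (x' (n + 1)) = x' n := by
    simp only [x']
    rw [← map_comp_element, Category.assoc, hα]
  have step (n : ℕ) (f : {f : W n ⟶ Y n // H.map f (w n) = x' n}) :
      ∃ f' : {f' : W (n + 1) ⟶ Y (n + 1) // H.map f' (w (n + 1)) = x' (n + 1)},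
        f'.1 ≫ φ n = p n ≫ f.1 := by
    obtain ⟨P, u, v, hP, hT''⟩ := hY n
    obtain ⟨f', h₁, h₂⟩ := exists_lift_of_distTriang hT'' (p n) (hp n)
      ((hcov (n + 1) 0 hP).of_retract (Retract.ofIso ((shiftFunctorZero T ℤ).symm.app P)))
      (hann n 1 hP) f.1 (x' (n + 1)) (by rw [f.2, hx'])
    exact ⟨⟨f', h₂⟩, h₁⟩
  choose next hnext using step
  obtain ⟨f₀, hf₀⟩ := (hcovY 0 0).of_retract (Retract.ofIso ((shiftFunctorZero T ℤ).symm.app _))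
    (x' 0)
  let f (n : ℕ) : {f : W n ⟶ Y n // H.map f (w n) = x' n} := Nat.rec ⟨f₀, hf₀⟩ next n
  have hf (n : ℕ) : (f (n + 1)).1 ≫ φ n = p n ≫ (f n).1 := hnext n (f n)
  let F : ∏ᶜ W ⟶ c.pt := Fan.IsLimit.lift hc fun n => Pi.π W n ≫ (f n).1
  have hF (n : ℕ) : F ≫ c.proj n = Pi.π W n ≫ (f n).1 := Fan.IsLimit.fac _ _ _
  obtain ⟨g, hg⟩ : ∃ g : W' ⟶ X, a ≫ F = g ≫ α := Triangle.coyoneda_exact₂ _ hT' (a ≫ F) (by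
    change (a ≫ F) ≫ (𝟙 c.pt - Fan.IsLimit.lift hc (fun n => c.proj (n + 1) ≫ φ n)) = 0
    refine Fan.IsLimit.hom_ext hc _ _ fun n => ?_
    simp only [Preadditive.comp_sub, Preadditive.sub_comp, Category.assoc, Category.comp_id,
      zero_comp, Fan.IsLimit.fac, hF]
    rw [reassoc_of% (hF (n + 1)), hf, reassoc_of% (ha n), sub_self])
  -- `g` sends `w'` to an element with the same components as `x` in every `H(Y n)`. The difference
  -- thus comes from the product shifted by `-1`, which `w'` covers too.
  obtain ⟨y, hy⟩ := exists_element_of_distTriang (inv_rot_of_distTriang _ hT')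
    (x - H.map g w') (by
      change H.map α _ = 0
      rw [map_sub, ← map_comp_element, ← hg, sub_eq_zero]
      refine element_ext_of_isLimit H hc fun n => ?_
      rw [← map_comp_element, ← map_comp_element, Category.assoc, hF, ← Category.assoc,
        map_comp_element (a ≫ Pi.π W n), hw'n, (f n).2])
  have hc' : IsLimit (Fan.mk (c.pt⟦(-1 : ℤ)⟧) fun j => (c.proj j)⟦(-1 : ℤ)⟧') :=
    isLimitMapConeFanMkEquiv (shiftFunctor T (-1 : ℤ)) Y c.proj
      (isLimitOfPreserves _ (IsLimit.ofIsoLimit hc (Cone.ext (Iso.refl _))))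
  obtain ⟨k, hk⟩ := Covers.of_isLimit (H := H) hc'
    (fun n => (hcovY n (-1)).of_hom (a ≫ Pi.π W n) (hw'n n)) y
  let δ : c.pt⟦(-1 : ℤ)⟧ ⟶ X := (Triangle.mk α (𝟙 c.pt -
    Fan.IsLimit.lift hc (fun n => c.proj (n + 1) ≫ φ n)) β).invRotate.mor₁
  refine ⟨g + k ≫ δ, ?_⟩
  rw [map_add_element, map_comp_element, hk]
  exact (congrArg _ hy).trans (add_sub_cancel _ _)

include hH in
/-- **Brown representability**: if all the objects of `T` are cofiltered by a set of objects, then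
any product preserving homological functor to abelian groups has a universal element. -/
theorem exists_universal_element {ι : Type} (G : ι → T)
    (hG : ∀ X : T, IsCofilteredBy (ObjectProperty.ofObj G) X) :
    ∃ (U : T) (u : H.obj U), ∀ X, Function.Bijective fun f : U ⟶ X => H.map f u := by
  have : HasProductsOfShape ℕ T :=
    hasLimitsOfShape_of_equivalence (Discrete.equivalence (Equiv.ulift.{v}))
  obtain ⟨W, w, hw⟩ := exists_weakly_initial hH G hG
  let E := {s : W ⟶ W // H.map s w = w}
  -- The fibre `q` of `φ` is a weak joint equalizer of the identity and all endomorphisms fixing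
  -- `w`.
  let φ : W ⟶ ∏ᶜ fun _ : E => W := Pi.lift fun s => s.1 - 𝟙 W
  obtain ⟨V, q, b, hT⟩ := distinguished_cocone_triangle₁ φ
  have hq (s : W ⟶ W) (hs : H.map s w = w) : q ≫ s = q := by
    have h0 : q ≫ φ = 0 := comp_distTriang_mor_zero₁₂ _ hT
    have h1 : φ ≫ Pi.π (fun _ : E => W) ⟨s, hs⟩ = s - 𝟙 W := Pi.lift_π _ _
    have h2 : q ≫ (s - 𝟙 W) = 0 := by rw [← h1, reassoc_of% h0, zero_comp]
    simpa [sub_eq_zero] using h2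
  obtain ⟨z, hz⟩ := exists_element_of_distTriang hT w (by
    refine element_ext_of_isLimit H (productIsProduct fun _ : E => W) fun s => ?_
    rw [← map_comp_element, map_zero]
    change H.map (φ ≫ Pi.π (fun _ : E => W) s) w = 0
    rw [Pi.lift_π, map_sub_element, s.2, H.map_id]
    exact sub_self w)
  obtain ⟨r, hr⟩ := hw V z
  -- As `r ≫ q` fixes `w`, it is absorbed by `q`, which makes it idempotent.
  have he : H.map (r ≫ q) w = w := by rw [map_comp_element, hr, hz]
  obtain ⟨U, π, i, hπi, hiπ⟩ := exists_splitting_of_idem (r ≫ q) (by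
    rw [Category.assoc, hq _ he])
  have hi : H.map i (H.map π w) = w := by rw [← map_comp_element, hπi, he]
  refine ⟨U, H.map π w, fun X => ⟨fun f g hfg => ?_, fun x => ?_⟩⟩
  · obtain ⟨C, c, b', hT'⟩ := distinguished_cocone_triangle₁ (f - g)
    have hc : c ≫ f = c ≫ g := by
      have h0 : c ≫ (f - g) = 0 := comp_distTriang_mor_zero₁₂ _ hT'
      simpa [sub_eq_zero] using h0
    obtain ⟨t, ht⟩ := exists_element_of_distTriang hT' (H.map π w) (by
      rw [map_sub_element]; exact sub_eq_zero.2 hfg)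
    obtain ⟨d, hd⟩ := hw C t
    -- The endomorphism `d ≫ c ≫ i` of `W` fixes `w`, so `q` absorbs it. It follows that `c` is a
    -- split epimorphism, and `c ≫ f = c ≫ g` forces `f = g`.
    have h1 : q ≫ d ≫ c ≫ i = q := hq _ (by
      rw [map_comp_element, map_comp_element, hd, ht, hi])
    have h2 : i ≫ d ≫ c = 𝟙 U := by
      have h3 : π ≫ i ≫ d ≫ c ≫ i = π ≫ i := by
        rw [← Category.assoc, hπi, Category.assoc, h1]
      have h4 := congrArg (fun f => i ≫ f ≫ π) h3
      simpa [reassoc_of% hiπ, hiπ] using h4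
    rw [← Category.id_comp f, ← Category.id_comp g, ← h2]
    simp only [Category.assoc, hc]
  · obtain ⟨f, hf⟩ := hw X x
    exact ⟨i ≫ f, by dsimp only; rw [map_comp_element, hi, hf]⟩

end Brown

/-! ### Kan extensions along a left adjoint. -/

section KanExtension

variable {C D H : Type*} [Category* C] [Category* D] [Category* H]

/-- The left Kan extension of a functor along a left adjoint is the composition with the right
adjoint. -/
lemma isLeftKanExtension_of_adjunction {L : C ⥤ D} {R : D ⥤ C} (adj : L ⊣ R) (F : C ⥤ H)
    (α : F ⟶ L ⋙ R ⋙ F) (hα : ∀ X, α.app X = F.map (adj.unit.app X)) :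
    (R ⋙ F).IsLeftKanExtension α where
  nonempty_isUniversal := ⟨IsInitial.ofUniqueHom
    (fun E => StructuredArrow.homMk
      ({ app := fun Z => E.hom.app (R.obj Z) ≫ E.right.map (adj.counit.app Z)
         naturality := fun Z Z' f => by
          have h₁ := E.hom.naturality (R.map f)
          have h₂ := congrArg E.right.map (adj.counit.naturality f)
          simp only [Functor.map_comp] at h₂
          dsimp at h₁ h₂ ⊢
          rw [reassoc_of% h₁, h₂, Category.assoc] } : R ⋙ F ⟶ E.right)
      (by
        ext X
        change α.app X ≫ E.hom.app (R.obj (L.obj X)) ≫ E.right.map (adj.counit.app (L.obj X)) = _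
        have h₁ := E.hom.naturality (adj.unit.app X)
        dsimp at h₁
        rw [hα, reassoc_of% h₁, ← Functor.map_comp]
        simp))
    (fun E m => by
      ext Z
      let τ : R ⋙ F ⟶ E.right := m.right
      have h₁ : α.app (R.obj Z) ≫ τ.app (L.obj (R.obj Z)) = E.hom.app (R.obj Z) :=
        NatTrans.congr_app (StructuredArrow.w m) (R.obj Z)
      have h₂ : F.map (R.map (adj.counit.app Z)) ≫ τ.app Z =
        τ.app (L.obj (R.obj Z)) ≫ E.right.map (adj.counit.app Z) :=
        τ.naturality (adj.counit.app Z)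
      have h₃ : F.map (adj.unit.app (R.obj Z)) ≫ F.map (R.map (adj.counit.app Z)) = 𝟙 _ := by
        rw [← F.map_comp, adj.right_triangle_components]
        exact F.map_id _
      change τ.app Z = E.hom.app (R.obj Z) ≫ E.right.map (adj.counit.app Z)
      rw [← h₁, Category.assoc, ← h₂, hα, reassoc_of% h₃])⟩

end KanExtension

/-! ### Consequences of the existence of homotopically injective resolutions. -/

section Resolutions

variable {A : Type u} [Category.{v} A] [Abelian A] [HasDerivedCategory.{w} A]

/-- `Qh` inverts the morphisms with acyclic cone, and acyclic complexes have no nonzero morphisms to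
`E`; so the localization does not change morphisms into `E`. -/
lemma Qh_map_bijective_of_homotopicallyInjective (X : HomotopyCategory A (ComplexShape.up ℤ))
    {E : HomotopyCategory A (ComplexShape.up ℤ)} (hE : homotopicallyInjective A E) :
    Function.Bijective (DerivedCategory.Qh.map : (X ⟶ E) → _) :=
  hE.map_bijective_of_isTriangulated _ _

variable (A) in
/-- The functor `K_inj(A) ⥤ K(A) ⥤ D(A)`. -/
abbrev KInjToDerived : KInj A ⥤ DerivedCategory A :=
  (homotopicallyInjective A).ι ⋙ DerivedCategory.Qh

variable (hA : ∀ X : HomotopyCategory A (ComplexShape.up ℤ),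
  ∃ (E : HomotopyCategory A (ComplexShape.up ℤ)) (f : X ⟶ E),
    IsHomotopicallyInjectiveResolution f)

instance : (KInjToDerived A).Faithful where
  map_injective {X Y} f g h := by
    ext
    exact (Qh_map_bijective_of_homotopicallyInjective X.obj Y.property).1 h

instance : (KInjToDerived A).Full where
  map_surjective {X Y} f := by
    obtain ⟨g, hg⟩ := (Qh_map_bijective_of_homotopicallyInjective X.obj Y.property).2 f
    exact ⟨ObjectProperty.homMk g, hg⟩

include hA in
lemma KInjToDerived_isEquivalence : (KInjToDerived A).IsEquivalence where
  essSurj := ⟨fun Z => by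
    obtain ⟨E, f, hf, hE⟩ := hA (DerivedCategory.Qh.objPreimage Z)
    have : IsIso (DerivedCategory.Qh.map f) :=
      Localization.inverts _ (HomotopyCategory.quasiIso A (ComplexShape.up ℤ)) f hf
    exact ⟨⟨E, hE⟩, ⟨(asIso (DerivedCategory.Qh.map f)).symm ≪≫
      DerivedCategory.Qh.objObjPreimageIso Z⟩⟩⟩

include hA in
lemma locallySmall_derivedCategory : LocallySmall.{v} (DerivedCategory A) where
  hom_small X Y := by
    have := KInjToDerived_isEquivalence hA
    let e := (KInjToDerived A).asEquivalence.symm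
    exact ⟨_, ⟨e.fullyFaithfulFunctor.homEquiv⟩⟩

-- The right adjoint sends `Z` to a homotopically injective complex representing it: morphisms from
-- `X` to this complex in `K(A)` are the morphisms from `X` to `Z` in `D(A)`.
include hA in
lemma Qh_isLeftAdjoint : (DerivedCategory.Qh (C := A)).IsLeftAdjoint := by
  have := KInjToDerived_isEquivalence hA
  let E (Z : DerivedCategory A) : KInj A := (KInjToDerived A).objPreimage Z
  let iso (Z : DerivedCategory A) : DerivedCategory.Qh.obj (E Z).obj ≅ Z :=
    (KInjToDerived A).objObjPreimageIso Z
  let e (X : HomotopyCategory A (ComplexShape.up ℤ)) (Z : DerivedCategory A) :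
      (DerivedCategory.Qh.obj X ⟶ Z) ≃ (X ⟶ (E Z).obj) :=
    ((Equiv.ofBijective _ (Qh_map_bijective_of_homotopicallyInjective X (E Z).property)).trans
      ((Iso.refl _).homCongr (iso Z))).symm
  have he (X : HomotopyCategory A (ComplexShape.up ℤ)) (Z : DerivedCategory A)
      (f : X ⟶ (E Z).obj) : (e X Z).symm f = DerivedCategory.Qh.map f ≫ (iso Z).hom := by
    simp [e, Iso.homCongr]
  exact (Adjunction.adjunctionOfEquivRight e (fun X' X Z f g => by
    apply (e X' Z).symm.injective
    rw [Equiv.symm_apply_apply, he, Functor.map_comp, Category.assoc, ← he,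
      Equiv.symm_apply_apply])).isLeftAdjoint

include hA in
lemma hasTotalRightDerivedFunctor {B : Type u'} [Category.{v'} B] [Abelian B]
    [HasDerivedCategory.{w'} B] (F : A ⥤ B) [F.Additive] : HasTotalRightDerivedFunctor F := by
  have := Qh_isLeftAdjoint hA
  let adj := Adjunction.ofIsLeftAdjoint (DerivedCategory.Qh (C := A))
  let R := (DerivedCategory.Qh (C := A)).rightAdjoint
  let _ : R.CommShift ℤ := adj.rightAdjointCommShift ℤ
  have : adj.CommShift ℤ := adj.commShift_of_leftAdjoint ℤ
  have : R.IsTriangulated := adj.isTriangulated_rightAdjoint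
  let F' := F.mapHomotopyCategory (ComplexShape.up ℤ) ⋙ DerivedCategory.Qh
  let α : F' ⟶ DerivedCategory.Qh ⋙ R ⋙ F' :=
    F'.leftUnitor.inv ≫ Functor.whiskerRight adj.unit F' ≫ (Functor.associator _ _ _).hom
  refine ⟨R ⋙ F', inferInstance, α, inferInstance, ?_, ?_⟩
  · infer_instance
  · rw [Functor.isRightDerivedFunctor_iff_isLeftKanExtension]
    exact isLeftKanExtension_of_adjunction adj F' α fun X => by simp [α]

variable (A) in
/-- Brown representability for the opposite of `D(A)` follows from the existence of universal
elements for functors from `K_inj(A)`. -/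
lemma opSatisfiesBrownRepresentability_derivedCategory [(KInjToDerived A).IsEquivalence]
    (hU : ∀ (H : KInj A ⥤ AddCommGrpCat.{v}) [H.IsHomological],
      (∀ J : Type v, PreservesLimitsOfShape (Discrete J) H) →
      ∃ (U : KInj A) (u : H.obj U), ∀ X, Function.Bijective fun f : U ⟶ X => H.map f u) :
    OpSatisfiesBrownRepresentability.{v} (DerivedCategory A) := by
  intro F _ hF
  obtain ⟨U, u, hu⟩ := hU (KInjToDerived A ⋙ F) (fun J => by have := hF J; infer_instance)
  -- Universality of `u` passes from `K_inj(A)` to `D(A)`, since each `Z` is isomorphic to the image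
  -- of an object of `K_inj(A)`.
  have hu' (Z : DerivedCategory A) :
      Function.Bijective fun f : (KInjToDerived A).obj U ⟶ Z => F.map f u := by
    let e := (KInjToDerived A).objObjPreimageIso Z
    refine ⟨fun f g hfg => ?_, fun z => ?_⟩
    · obtain ⟨f', hf'⟩ := (KInjToDerived A).map_surjective (f ≫ e.inv)
      obtain ⟨g', hg'⟩ := (KInjToDerived A).map_surjective (g ≫ e.inv)
      rw [← cancel_mono e.inv, ← hf', ← hg']
      refine congrArg _ ((hu _).1 ?_)
      change F.map ((KInjToDerived A).map f') u = F.map ((KInjToDerived A).map g') u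
      rw [hf', hg', map_comp_element, map_comp_element]
      exact congrArg _ hfg
    · obtain ⟨f, hf⟩ := (hu _).2 (F.map e.inv z)
      refine ⟨(KInjToDerived A).map f ≫ e.hom, ?_⟩
      change F.map ((KInjToDerived A).map f) u = _ at hf
      dsimp only
      rw [map_comp_element, hf, ← map_comp_element, e.inv_hom_id, F.map_id]
      rfl
  let e (Z : DerivedCategory A) : ((KInjToDerived A).obj U ⟶ Z) ≃+ F.obj Z :=
    AddEquiv.ofBijective
      (⟨⟨fun f => F.map f u, by rw [F.map_zero]; rfl⟩, fun f g => map_add_element f g u⟩ :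
        ((KInjToDerived A).obj U ⟶ Z) →+ F.obj Z) (hu' Z)
  refine ⟨(KInjToDerived A).obj U, ⟨(NatIso.ofComponents (fun Z =>
    AddEquiv.toAddCommGrpIso (AddEquiv.ulift.trans ((e Z).trans AddEquiv.ulift.symm))) ?_).symm⟩⟩
  intro Z Z' f
  ext ⟨x⟩
  exact congrArg ULift.up (map_comp_element x f u)

end Resolutions

/-! ### Enough injectives, and a criterion for injective resolutions. -/

section InjectiveResolutions

variable {A : Type u} [Category.{v} A] [Abelian A]

lemma enoughInjectives_of_isCoseparator [HasProducts.{v} A] (Q : A) [Injective Q]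
    (hQ : IsCoseparator Q) : EnoughInjectives A where
  presentation X := ⟨{
    J := ∏ᶜ fun _ : X ⟶ Q => Q
    f := Pi.lift fun f => f
    mono := (isCoseparator_iff_mono Q).1 hQ X }⟩

lemma isInjectiveResolution_of_exact {Z : A} (I : CochainComplex A ℕ) (ε : Z ⟶ I.X 0)
    (hI : ∀ n, Injective (I.X n)) (hε : Mono ε) (w : ε ≫ I.d 0 1 = 0)
    (h₀ : (ShortComplex.mk ε (I.d 0 1) w).Exact)
    (h : ∀ n, (ShortComplex.mk (I.d n (n + 1)) (I.d (n + 1) (n + 2)) (I.d_comp_d _ _ _)).Exact) :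
    IsInjectiveResolution I ε where
  injective := hI
  comp_d := w
  quasiIso := ⟨fun n => by
    rcases n with _ | n
    · rw [CochainComplex.quasiIsoAt₀_iff, ShortComplex.quasiIso_iff_of_zeros]
      · refine (ShortComplex.exact_and_mono_f_iff_of_iso ?_).2 ⟨h₀, hε⟩
        exact ShortComplex.isoMk (Iso.refl _) (Iso.refl _) (Iso.refl _)
          (by simp; exact (Category.id_comp ε).trans (Category.comp_id ε).symm)
          (by simp; exact (Category.id_comp _).trans (Category.comp_id _).symm)
      · rfl
      · rfl
      · exact I.shape _ _ (by simp)
    · rw [quasiIsoAt_iff_exactAt]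
      · rw [HomologicalComplex.exactAt_iff' _ n (n + 1) (n + 2) (by simp) (by simp)]
        exact h n
      · apply CochainComplex.exactAt_succ_single_obj⟩

end InjectiveResolutions

/-! ### Short exact sequences of complexes whose first map is mono on cohomology. -/

section Exactness

variable {A : Type u} [Category.{v} A] [Abelian A] {S : ShortComplex (CochainComplex A ℤ)}
  (hS : S.ShortExact) (hf : ∀ i, Mono (HomologicalComplex.homologyMap S.f i))

/-- The morphism `B^i(X) ⟶ B^i(Y)` induced by a morphism of complexes. -/
def boundariesMap {X Y : CochainComplex A ℤ} (f : X ⟶ Y) (i : ℤ) :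
    image (X.d (i - 1) i) ⟶ image (Y.d (i - 1) i) := (boundariesFunctor A i).map f

lemma boundariesMap_ι {X Y : CochainComplex A ℤ} (f : X ⟶ Y) (i : ℤ) :
    boundariesMap f i ≫ image.ι (Y.d (i - 1) i) = image.ι (X.d (i - 1) i) ≫ f.f i :=
  image.map_ι _

lemma factorThruImage_boundariesMap {X Y : CochainComplex A ℤ} (f : X ⟶ Y) (i : ℤ) :
    factorThruImage (X.d (i - 1) i) ≫ boundariesMap f i =
      f.f (i - 1) ≫ factorThruImage (Y.d (i - 1) i) := by
  rw [← cancel_mono (image.ι (Y.d (i - 1) i)), Category.assoc, boundariesMap_ι,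
    image.fac_assoc, Category.assoc, image.fac, f.comm]

include hS hf

/-- The connecting morphism followed by the monomorphism `H(f)` is zero, so it vanishes. -/
lemma epi_homologyMap_of_mono (i : ℤ) : Epi (HomologicalComplex.homologyMap S.g i) := by
  have h0 : hS.δ i (i + 1) (by simp) = 0 := by
    have := hf (i + 1)
    rw [← cancel_mono (HomologicalComplex.homologyMap S.f (i + 1)), hS.δ_comp, zero_comp]
  exact (hS.homology_exact₃ i (i + 1) (by simp)).epi_f h0

lemma shortExact_map_homologyFunctor (i : ℤ) :
    (S.map (HomologicalComplex.homologyFunctor A (ComplexShape.up ℤ) i)).ShortExact where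
  exact := hS.homology_exact₂ i
  mono_f := hf i
  epi_g := epi_homologyMap_of_mono hS hf i

lemma shortExact_map_cyclesFunctor (i : ℤ) :
    (S.map (HomologicalComplex.cyclesFunctor A (ComplexShape.up ℤ) i)).ShortExact where
  exact := by
    have := hS.mono_f
    exact HomologicalComplex.cycles_left_exact S hS.exact i
  mono_f := by
    have := hS.mono_f
    exact inferInstanceAs (Mono (HomologicalComplex.cyclesMap S.f i))
  epi_g := by
    have := hS.epi_g
    have := epi_homologyMap_of_mono hS hf i
    rw [HomologicalComplex.epi_homologyMap_iff_up_to_refinements S.g (i - 1) i (i + 1)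
      (by simp) (by simp)] at this
    change Epi (HomologicalComplex.cyclesMap S.g i)
    rw [epi_iff_surjective_up_to_refinements]
    intro T y
    -- The class of `y` lifts to a cocycle `x₂`; the remaining error is the boundary of `y₁`, and
    -- `y₁` lifts because `S.g` is epi.
    obtain ⟨T₁, π₁, _, x₂, hx₂, y₁, h₁⟩ := this (y ≫ S.X₃.iCycles i) (by simp)
    obtain ⟨T₂, π₂, _, x₁, h₂⟩ := surjective_up_to_refinements_of_epi (S.g.f (i - 1)) y₁
    refine ⟨T₂, π₂ ≫ π₁, inferInstance, S.X₂.liftCycles (π₂ ≫ x₂ + x₁ ≫ S.X₂.d (i - 1) i) (i + 1)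
      (by simp) (by simp [hx₂]), ?_⟩
    rw [← cancel_mono (S.X₃.iCycles i)]
    simp [h₁, reassoc_of% h₂]

/-- Monicity of `H(f)` is what gives exactness in the middle: a cocycle of the subcomplex which
becomes a boundary in `S.X₂` is already a boundary. -/
lemma shortExact_map_boundariesFunctor (i : ℤ) :
    (S.map (boundariesFunctor A i)).ShortExact := by
  have hS' (i : ℤ) := (HomologicalComplex.shortExact_iff_degreewise_shortExact S).1 hS i
  have hmf (i : ℤ) : Mono (S.f.f i) := (hS' i).mono_f
  have heg (i : ℤ) : Epi (S.g.f i) := (hS' i).epi_g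
  have hfg : boundariesMap S.f i ≫ boundariesMap S.g i = 0 := (S.map (boundariesFunctor A i)).zero
  suffices (ShortComplex.mk _ _ hfg).ShortExact from this
  have hm := hf i
  rw [HomologicalComplex.mono_homologyMap_iff_up_to_refinements S.f (i - 1) i (i + 1)
    (by simp) (by simp)] at hm
  have h₁ : Mono (boundariesMap S.f i) := by
    have : Mono (boundariesMap S.f i ≫ image.ι (S.X₂.d (i - 1) i)) := by
      rw [boundariesMap_ι]
      infer_instance
    exact mono_of_mono _ (image.ι (S.X₂.d (i - 1) i))
  have h₂ : Epi (boundariesMap S.g i) := by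
    have : Epi (factorThruImage (S.X₂.d (i - 1) i) ≫ boundariesMap S.g i) := by
      rw [factorThruImage_boundariesMap]
      infer_instance
    exact epi_of_epi (factorThruImage (S.X₂.d (i - 1) i)) _
  refine { exact := ?_, mono_f := h₁, epi_g := h₂ }
  rw [ShortComplex.exact_iff_exact_up_to_refinements]
  intro T b hb
  obtain ⟨T₁, π₁, _, (x : T₁ ⟶ S.X₁.X i), (hx : π₁ ≫ b ≫ image.ι _ = x ≫ S.f.f i)⟩ :=
    (hS' i).exact.exact_up_to_refinements (b ≫ image.ι _) (by
      have := congrArg (fun f => f ≫ image.ι (S.X₃.d (i - 1) i)) hb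
      rw [Category.assoc, boundariesMap_ι, zero_comp] at this
      exact (Category.assoc _ _ _).trans this)
  obtain ⟨T₂, π₂, _, y, hy⟩ := surjective_up_to_refinements_of_epi
    (factorThruImage (S.X₂.d (i - 1) i)) (π₁ ≫ b)
  have hxy : (π₂ ≫ x) ≫ S.f.f i = y ≫ S.X₂.d (i - 1) i := by
    rw [Category.assoc, ← hx, ← Category.assoc π₁, ← Category.assoc, hy, Category.assoc, image.fac]
  obtain ⟨T₃, π₃, _, x₁, h₃⟩ := hm (π₂ ≫ x) (by
    rw [← cancel_mono (S.f.f (i + 1)), Category.assoc, ← S.f.comm, ← Category.assoc, hxy]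
    simp) y hxy
  refine ⟨T₃, π₃ ≫ π₂ ≫ π₁, inferInstance, x₁ ≫ factorThruImage _, ?_⟩
  change (π₃ ≫ π₂ ≫ π₁) ≫ b = (x₁ ≫ factorThruImage _) ≫ boundariesMap S.f i
  rw [← cancel_mono (image.ι _), Category.assoc, Category.assoc, Category.assoc,
    Category.assoc, Category.assoc, boundariesMap_ι, image.fac_assoc, hx, reassoc_of% h₃]

end Exactness

/-! ### Existence of Cartan–Eilenberg resolutions with split columns. -/

section Splittings

variable {A : Type u} [Category.{v} A] [Abelian A]

/-- A strong deformation retraction of a complex `K` onto a complex `U` with zero differential. -/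
structure CESplitting (K : CochainComplex A ℤ) where
  U : ℤ → A
  p (i : ℤ) : K.X i ⟶ U i
  s (i : ℤ) : U i ⟶ K.X i
  h (i j : ℤ) : K.X i ⟶ K.X j
  d_p (i j : ℤ) : K.d i j ≫ p j = 0
  s_d (i j : ℤ) : s i ≫ K.d i j = 0
  s_p (i : ℤ) : s i ≫ p i = 𝟙 (U i)
  homotopy (i j k : ℤ) (hij : i + 1 = j) (hjk : j + 1 = k) :
    K.d j k ≫ h k j + h j i ≫ K.d i j = 𝟙 (K.X j) - p j ≫ s j

namespace CESplitting

variable {K : CochainComplex A ℤ} (σ : CESplitting K)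

/-- This regularity of the differential makes the cocycles and the boundaries direct factors of the
terms of `K`, hence injective when those terms are. -/
lemma d_h_d (i j : ℤ) (hij : i + 1 = j) : K.d i j ≫ σ.h j i ≫ K.d i j = K.d i j := by
  have := congrArg (fun f => K.d i j ≫ f) (σ.homotopy i j (j + 1) hij rfl)
  simpa [reassoc_of% (σ.d_p i j)] using this

lemma injective_U (hK : ∀ i, Injective (K.X i)) (i : ℤ) : Injective (σ.U i) :=
  have := hK i
  Retract.injective (Y := K.X i) { i := σ.s i, r := σ.p i, retract := σ.s_p i }

include σ

lemma injective_cycles (hK : ∀ i, Injective (K.X i)) (i : ℤ) : Injective (K.cycles i) := by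
  have := hK i
  refine Retract.injective (Y := K.X i)
    { i := K.iCycles i
      r := K.liftCycles (𝟙 _ - K.d i (i + 1) ≫ σ.h (i + 1) i) (i + 1) (by simp) (by
        rw [Preadditive.sub_comp, Category.assoc, σ.d_h_d i (i + 1) rfl]; simp)
      retract := ?_ }
  rw [← cancel_mono (K.iCycles i)]
  simp

lemma injective_boundaries (hK : ∀ i, Injective (K.X i)) (i j : ℤ) (hij : i + 1 = j) :
    Injective (image (K.d i j)) := by
  have := hK j
  refine Retract.injective (Y := K.X j)
    { i := image.ι _
      r := σ.h j i ≫ factorThruImage _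
      retract := ?_ }
  rw [← cancel_mono (image.ι _), ← cancel_epi (factorThruImage _)]
  simp [σ.d_h_d i j hij]

/-- On cocycles the identity differs from `p ≫ s` by a boundary, so cohomology is a retract of the
injective object `U i`. -/
lemma injective_homology (hK : ∀ i, Injective (K.X i)) (i : ℤ) : Injective (K.homology i) := by
  have := σ.injective_U hK i
  refine Retract.injective (Y := σ.U i)
    { i := K.homologyι i ≫ K.descOpcycles (σ.p i) (i - 1) (by simp) (σ.d_p _ _)
      r := K.liftCycles (σ.s i) (i + 1) (by simp) (σ.s_d _ _) ≫ K.homologyπ i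
      retract := ?_ }
  have h₁ : K.iCycles i ≫ σ.p i ≫ K.liftCycles (σ.s i) (i + 1) (by simp) (σ.s_d _ _) =
      𝟙 _ - (K.iCycles i ≫ σ.h i (i - 1)) ≫ K.toCycles (i - 1) i := by
    rw [← cancel_mono (K.iCycles i)]
    have := congrArg (fun f => K.iCycles i ≫ f)
      (σ.homotopy (i - 1) i (i + 1) (by simp) rfl)
    simp only [Preadditive.comp_add, Preadditive.comp_sub, K.iCycles_d_assoc, zero_comp,
      zero_add, Category.comp_id] at this
    simp [this]
  rw [← cancel_epi (K.homologyπ i), Category.assoc, K.homology_π_ι_assoc,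
    K.p_descOpcycles_assoc, ← Category.assoc (σ.p i), ← Category.assoc, h₁]
  simp

end CESplitting

/-- The complex `(V i ⊞ V (i + 1) ⊞ U i)_i`, the direct sum of the contractible complexes
`V i = V i` in degrees `i - 1` and `i`, and of the objects `U i`. -/
def ceComplex (V U : ℤ → A) : CochainComplex A ℤ :=
  CochainComplex.of (fun i => V i ⊞ (V (i + 1) ⊞ U i))
    (fun _ => biprod.snd ≫ biprod.fst ≫ biprod.inl) (fun i => by simp)

namespace ceComplex

variable (V U : ℤ → A) (i : ℤ)

/-- The isomorphism which unfolds the definition of `ceComplex`. -/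
def XIso : (ceComplex V U).X i ≅ V i ⊞ (V (i + 1) ⊞ U i) := Iso.refl _

def π₁ : (ceComplex V U).X i ⟶ V i := (XIso V U i).hom ≫ biprod.fst

def π₂ : (ceComplex V U).X i ⟶ V (i + 1) := (XIso V U i).hom ≫ biprod.snd ≫ biprod.fst

def π₃ : (ceComplex V U).X i ⟶ U i := (XIso V U i).hom ≫ biprod.snd ≫ biprod.snd

def ι₁ : V i ⟶ (ceComplex V U).X i := biprod.inl ≫ (XIso V U i).inv

def ι₂ : V (i + 1) ⟶ (ceComplex V U).X i := biprod.inl ≫ biprod.inr ≫ (XIso V U i).inv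

def ι₃ : U i ⟶ (ceComplex V U).X i := biprod.inr ≫ biprod.inr ≫ (XIso V U i).inv

variable {V U i} in
lemma hom_ext {T : A} {f g : T ⟶ (ceComplex V U).X i} (h₁ : f ≫ π₁ V U i = g ≫ π₁ V U i)
    (h₂ : f ≫ π₂ V U i = g ≫ π₂ V U i) (h₃ : f ≫ π₃ V U i = g ≫ π₃ V U i) : f = g := by
  rw [← cancel_mono (XIso V U i).hom]
  apply biprod.hom_ext
  · simpa [π₁] using h₁
  · apply biprod.hom_ext
    · simpa [π₂] using h₂
    · simpa [π₃] using h₃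

lemma d_eq : (ceComplex V U).d i (i + 1) = π₂ V U i ≫ ι₁ V U (i + 1) := by
  refine (CochainComplex.of_d (fun i => V i ⊞ (V (i + 1) ⊞ U i))
    (fun _ => biprod.snd ≫ biprod.fst ≫ biprod.inl) i).trans ?_
  change _ = (𝟙 (V i ⊞ (V (i + 1) ⊞ U i)) ≫ biprod.snd ≫ biprod.fst) ≫
    biprod.inl ≫ 𝟙 (V (i + 1) ⊞ (V (i + 1 + 1) ⊞ U (i + 1)))
  rw [Category.id_comp, Category.comp_id, Category.assoc]

lemma d_π₃ (i j : ℤ) : (ceComplex V U).d i j ≫ π₃ V U j = 0 := by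
  by_cases hij : i + 1 = j
  · subst hij
    simp [d_eq, π₃, ι₁]
  · rw [(ceComplex V U).shape _ _ (by simpa using hij), zero_comp]

lemma injective_X (hV : ∀ i, Injective (V i)) (hU : ∀ i, Injective (U i)) :
    Injective ((ceComplex V U).X i) :=
  Injective.of_iso (XIso V U i).symm inferInstance

/-- The complex `ceComplex V U` retracts by deformation onto `U`. -/
def splitting : CESplitting (ceComplex V U) where
  U := U
  p := π₃ V U
  s := ι₃ V U
  h i j := if hij : j + 1 = i then
    π₁ V U i ≫ eqToHom (by rw [hij]) ≫ ι₂ V U j else 0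
  d_p := d_π₃ V U
  s_d i j := by
    by_cases hij : i + 1 = j
    · subst hij
      simp [d_eq, π₂, ι₃]
    · rw [(ceComplex V U).shape _ _ (by simpa using hij), comp_zero]
  s_p i := by simp [π₃, ι₃]
  homotopy i j k hij hjk := by
    subst hij hjk
    apply hom_ext <;> simp [d_eq, π₁, π₂, π₃, ι₁, ι₂, ι₃]

end ceComplex

section

variable [EnoughInjectives A] (X : CochainComplex A ℤ)

/-- A Cartan–Eilenberg injective complex in which `X` embeds. -/
abbrev ceUnder : CochainComplex A ℤ :=
  ceComplex (fun i => Injective.under (X.X i)) (fun i => Injective.under (X.opcycles i))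

instance (i : ℤ) : Injective ((ceUnder X).X i) :=
  ceComplex.injective_X _ _ _ (fun _ => inferInstance) (fun _ => inferInstance)

open ceComplex in
/-- The embedding of a complex `X` into a Cartan–Eilenberg injective complex. -/
def toCE : X ⟶ ceUnder X where
  -- The first component makes the map mono, the second is forced by compatibility with the
  -- differentials, and the third, through the opcycles, makes it mono on cohomology.
  f i := Injective.ι (X.X i) ≫ ι₁ (fun i => Injective.under (X.X i)) _ i +
    (X.d i (i + 1) ≫ Injective.ι (X.X (i + 1)) ≫ ι₂ (fun i => Injective.under (X.X i)) _ i +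
    X.pOpcycles i ≫ Injective.ι (X.opcycles i) ≫
      ι₃ _ (fun i => Injective.under (X.opcycles i)) i)
  comm' i j hij := by
    obtain rfl : i + 1 = j := hij
    simp [d_eq, π₂, ι₁, ι₂, ι₃]

open ceComplex in
lemma toCE_π₁ (i : ℤ) : (toCE X).f i ≫ π₁ _ _ i = Injective.ι (X.X i) := by
  simp [toCE, π₁, ι₁, ι₂, ι₃]

open ceComplex in
lemma toCE_π₃ (i : ℤ) : (toCE X).f i ≫ π₃ _ _ i =
    X.pOpcycles i ≫ Injective.ι (X.opcycles i) := by
  simp [toCE, π₃, ι₁, ι₂, ι₃]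

instance (i : ℤ) : Mono ((toCE X).f i) :=
  have : Mono ((toCE X).f i ≫ ceComplex.π₁ _ _ i) := by
    rw [toCE_π₁]
    infer_instance
  mono_of_mono _ (ceComplex.π₁ _ _ i)

instance : Mono (toCE X) := HomologicalComplex.mono_of_mono_f _ inferInstance

/-- The projection `π₃` kills boundaries. If a cocycle of `X` becomes a boundary, it therefore
vanishes in the opcycles of `X`, so it is locally a boundary. -/
lemma mono_homologyMap_toCE (i : ℤ) : Mono (HomologicalComplex.homologyMap (toCE X) i) := by
  rw [HomologicalComplex.mono_homologyMap_iff_up_to_refinements (toCE X) (i - 1) i (i + 1)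
    (by simp) (by simp)]
  intro T x hx y hxy
  rw [← X.comp_pOpcycles_eq_zero_iff_up_to_refinements x (i - 1) (by simp),
    ← cancel_mono (Injective.ι _), Category.assoc, ← toCE_π₃, ← Category.assoc, hxy,
    Category.assoc, ceComplex.d_π₃, comp_zero, zero_comp]

end

section Existence

variable [EnoughInjectives A] (X : CochainComplex A ℤ)

/-- The iterated cokernels of the embeddings into Cartan–Eilenberg injective complexes. -/
def ceSyzygy : ℕ → CochainComplex A ℤ
  | 0 => X
  | n + 1 => cokernel (toCE (ceSyzygy n))

def ceι (n : ℕ) : ceSyzygy X n ⟶ ceUnder (ceSyzygy X n) := toCE _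

def ceπ (n : ℕ) : ceUnder (ceSyzygy X n) ⟶ ceSyzygy X (n + 1) := cokernel.π (toCE _)

lemma ceι_ceπ (n : ℕ) : ceι X n ≫ ceπ X n = 0 := cokernel.condition _

/-- The short exact sequence `0 ⟶ Xₙ ⟶ ceUnder Xₙ ⟶ Xₙ₊₁ ⟶ 0`. -/
def ceShortComplex (n : ℕ) : ShortComplex (CochainComplex A ℤ) :=
  ShortComplex.mk (ceι X n) (ceπ X n) (ceι_ceπ X n)

lemma shortExact_ceShortComplex (n : ℕ) : (ceShortComplex X n).ShortExact where
  exact := ShortComplex.exact_cokernel (toCE (ceSyzygy X n))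
  mono_f := inferInstanceAs (Mono (toCE (ceSyzygy X n)))
  epi_g := inferInstanceAs (Epi (cokernel.π (toCE (ceSyzygy X n))))

/-- The double complex of the Cartan–Eilenberg resolution of `X`. -/
def ceResolution : DoubleComplex A :=
  CochainComplex.of (fun n => ceUnder (ceSyzygy X n)) (fun n => ceπ X n ≫ ceι X (n + 1))
    (fun n => by
      rw [Category.assoc, ← Category.assoc (ceι X (n + 1)), ceι_ceπ, zero_comp, comp_zero])

lemma ceResolution_d (n : ℕ) :
    (ceResolution X).d n (n + 1) = ceπ X n ≫ ceι X (n + 1) :=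
  CochainComplex.of_d (fun n => ceUnder (ceSyzygy X n)) (fun n => ceπ X n ≫ ceι X (n + 1)) n

/-- The augmentation of the Cartan–Eilenberg resolution of `X`. -/
def ceResolutionε : X ⟶ (ceResolution X).X 0 := ceι X 0

lemma ceResolutionε_comp_d : ceResolutionε X ≫ (ceResolution X).d 0 1 = 0 := by
  rw [ceResolution_d X 0]
  exact (Category.assoc _ _ _).symm.trans ((congrArg (· ≫ ceι X 1) (ceι_ceπ X 0)).trans zero_comp)

/-- Splicing exact sequences. -/
lemma exact_epi_comp_comp_mono {W X Y Z T : A} {p : W ⟶ X} {f : X ⟶ Y} {g : Y ⟶ Z} {m : Z ⟶ T}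
    {w : f ≫ g = 0} (h : (ShortComplex.mk f g w).Exact) [Epi p] [Mono m]
    (w' : (p ≫ f) ≫ g ≫ m = 0) : (ShortComplex.mk (p ≫ f) (g ≫ m) w').Exact := by
  rw [ShortComplex.exact_iff_exact_up_to_refinements] at h ⊢
  intro V x hx
  have hx' : x ≫ g = 0 := by
    rw [← cancel_mono m, zero_comp, Category.assoc]
    exact hx
  obtain ⟨V₁, π₁, _, x₁, h₁⟩ := h x hx'
  obtain ⟨V₂, π₂, _, x₂, h₂⟩ := surjective_up_to_refinements_of_epi p x₁
  dsimp at x₁ h₁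
  refine ⟨V₂, π₂ ≫ π₁, inferInstance, x₂, ?_⟩
  rw [Category.assoc, h₁, reassoc_of% h₂]

lemma exact_of_eq {W Y Z : A} {f f' : W ⟶ Y} {g g' : Y ⟶ Z} {w : f ≫ g = 0}
    (h : (ShortComplex.mk f g w).Exact) (hf : f' = f) (hg : g' = g) (w' : f' ≫ g' = 0) :
    (ShortComplex.mk f' g' w').Exact := by
  subst hf hg
  exact h

/-- Short exact sequences of syzygies that remain exact under `G` splice to a resolution; this
treats all four conditions of a Cartan–Eilenberg resolution uniformly. -/
lemma resolvesUnder_ceResolution (G : CochainComplex A ℤ ⥤ A) [G.PreservesZeroMorphisms]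
    (hG : ∀ n, ((ceShortComplex X n).map G).ShortExact)
    (hG' : ∀ n, Injective (G.obj (ceUnder (ceSyzygy X n)))) :
    ResolvesUnder G (ceResolution X) (ceResolutionε X) := by
  have hmono (n : ℕ) : Mono (G.map (ceι X n)) := (hG n).mono_f
  have hepi (n : ℕ) : Epi (G.map (ceπ X n)) := (hG n).epi_g
  have hw (n : ℕ) : G.map (ceι X n) ≫ G.map (ceπ X n) = 0 := by
    rw [← G.map_comp, ceι_ceπ, G.map_zero]
  have hex (n : ℕ) : (ShortComplex.mk _ _ (hw n)).Exact := (hG n).exact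
  have hd (n : ℕ) : ((G.mapHomologicalComplex (ComplexShape.up ℕ)).obj (ceResolution X)).d n (n + 1)
      = G.map (ceπ X n) ≫ G.map (ceι X (n + 1)) := by
    rw [← G.map_comp, ← ceResolution_d]
    rfl
  refine isInjectiveResolution_of_exact _ _ hG' (hmono 0) ?_ ?_ fun n => ?_
  · rw [hd 0]
    exact (Category.assoc _ _ _).symm.trans
      ((congrArg (· ≫ G.map (ceι X 1)) (hw 0)).trans zero_comp)
  · refine exact_of_eq (exact_epi_comp_comp_mono (p := 𝟙 _) (m := G.map (ceι X 1)) (hex 0) ?_)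
      (Category.id_comp _).symm (hd 0) _
    rw [Category.id_comp, ← Category.assoc, hw, zero_comp]
  · refine exact_of_eq (exact_epi_comp_comp_mono (p := G.map (ceπ X n))
      (m := G.map (ceι X (n + 2))) (hex (n + 1)) ?_) (hd n) (hd (n + 1)) _
    rw [Category.assoc, ← Category.assoc (G.map (ceι X (n + 1))), hw, zero_comp, comp_zero]

lemma exists_ceInjectiveResolution :
    ∃ R : CEInjectiveResolution X, (∀ i j, Injective ((R.E.X j).X i)) ∧
      ∀ j, Nonempty (CESplitting (R.E.X j)) := by
  have hS := shortExact_ceShortComplex X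
  have hm (n : ℕ) := mono_homologyMap_toCE (ceSyzygy X n)
  have σ (n : ℕ) : CESplitting (ceUnder (ceSyzygy X n)) := ceComplex.splitting _ _
  exact ⟨{
    E := ceResolution X
    ε := ceResolutionε X
    ε_comp_d := ceResolutionε_comp_d X
    resolves_cohomology i := resolvesUnder_ceResolution X _
      (fun n => shortExact_map_homologyFunctor (hS n) (hm n) i)
      fun n => (σ n).injective_homology inferInstance i
    resolves_boundaries i := resolvesUnder_ceResolution X _
      (fun n => shortExact_map_boundariesFunctor (hS n) (hm n) i)
      fun n => (σ n).injective_boundaries inferInstance (i - 1) i (by simp)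
    resolves_cocycles i := resolvesUnder_ceResolution X _
      (fun n => shortExact_map_cyclesFunctor (hS n) (hm n) i)
      fun n => (σ n).injective_cycles inferInstance i
    resolves_objects i := resolvesUnder_ceResolution X _
      (fun n => (HomologicalComplex.shortExact_iff_degreewise_shortExact _).1 (hS n) i)
      fun n => inferInstanceAs (Injective ((ceUnder (ceSyzygy X n)).X i)) },
    fun i j => (inferInstance : Injective ((ceUnder (ceSyzygy X j)).X i)),
    fun n => ⟨σ n⟩⟩

end Existence

end Splittings

/-! ### Products of complexes, in `K(A)` and in `K_inj(A)`. -/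

section Products

/-- The universal property of products. -/
def IsUniversalFan {C : Type*} [Category* C] {J : Type*} {Y : J → C} {P : C}
    (π : ∀ j, P ⟶ Y j) : Prop :=
  ∀ (T : C) (f : ∀ j, T ⟶ Y j), ∃! g : T ⟶ P, ∀ j, g ≫ π j = f j

lemma IsUniversalFan.nonempty_isLimit {C : Type*} [Category* C] {J : Type*} {Y : J → C} {P : C}
    {π : ∀ j, P ⟶ Y j} (h : IsUniversalFan π) : Nonempty (IsLimit (Fan.mk P π)) :=
  ⟨Fan.IsLimit.mk _ (fun s => (h s.pt s.proj).choose)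
    (fun s j => (h s.pt s.proj).choose_spec.1 j)
    (fun s m hm => (h s.pt s.proj).choose_spec.2 m hm)⟩

lemma IsUniversalFan.comp_iso {C : Type*} [Category* C] {J : Type*} {Y Y' : J → C} {P : C}
    {π : ∀ j, P ⟶ Y j} (h : IsUniversalFan π) (e : ∀ j, Y j ≅ Y' j) :
    IsUniversalFan fun j => π j ≫ (e j).hom := by
  intro T f
  obtain ⟨g, hg, hg'⟩ := h T fun j => f j ≫ (e j).inv
  refine ⟨g, fun j => by simp [reassoc_of% (hg j)], fun g₁ h₁ => hg' g₁ fun j => ?_⟩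
  rw [← h₁ j]
  simp

variable {A : Type u} [Category.{v} A] [Abelian A]

lemma exists_lift_of_isUniversalFan {J : Type*} {Y : J → CochainComplex A ℤ}
    {P T : CochainComplex A ℤ} (π : ∀ j, P ⟶ Y j) (h : ∀ n, IsUniversalFan fun j => (π j).f n)
    (f : ∀ j, T ⟶ Y j) : ∃ g : T ⟶ P, ∀ j, g ≫ π j = f j := by
  choose g hg using fun n => (h n (T.X n) fun j => (f j).f n).exists
  exact ⟨{
    f := g
    comm' := fun m n _ => (h n (T.X m) fun j => (f j).f m ≫ (Y j).d m n).unique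
      (fun j => by rw [Category.assoc, ← (π j).comm, ← Category.assoc, hg])
      (fun j => by rw [Category.assoc, hg, (f j).comm]) },
    fun j => by ext n; exact hg n j⟩

/-- Existence holds because representatives of the components assemble to a chain map, and
uniqueness because chosen homotopies assemble too. -/
lemma isUniversalFan_quotient {J : Type*} {Y : J → CochainComplex A ℤ} {P : CochainComplex A ℤ}
    (π : ∀ j, P ⟶ Y j) (h : ∀ n, IsUniversalFan fun j => (π j).f n) :
    IsUniversalFan fun j => (HomotopyCategory.quotient A (ComplexShape.up ℤ)).map (π j) := by
  intro T f
  obtain ⟨T, rfl⟩ := HomotopyCategory.quotient_obj_surjective T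
  choose f' hf' using fun j => (HomotopyCategory.quotient A (ComplexShape.up ℤ)).map_surjective (f j)
  obtain rfl : (fun j => (HomotopyCategory.quotient A _).map (f' j)) = f := funext hf'
  have hext (n : ℤ) {Z : A} {a b : Z ⟶ P.X n} (hab : ∀ j, a ≫ (π j).f n = b ≫ (π j).f n) :
      a = b := (h n Z fun j => b ≫ (π j).f n).unique hab fun _ => rfl
  obtain ⟨g', hg'⟩ := exists_lift_of_isUniversalFan π h f'
  refine ⟨(HomotopyCategory.quotient A _).map g', fun j => ?_, fun b hb => ?_⟩
  · exact (Functor.map_comp _ _ _).symm.trans (congrArg _ (hg' j))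
  · obtain ⟨b, rfl⟩ := (HomotopyCategory.quotient A (ComplexShape.up ℤ)).map_surjective b
    have H (j : J) : Homotopy (b ≫ π j) (g' ≫ π j) := HomotopyCategory.homotopyOfEq _ _ (by
      rw [hg']
      exact (Functor.map_comp _ _ _).trans (hb j))
    choose k hk using fun i n => (h n (T.X i) fun j => (H j).hom i n).exists
    refine HomotopyCategory.eq_of_homotopy _ _
      { hom := k
        zero := fun i j hij => hext j fun l => by rw [hk, (H l).zero i j hij, zero_comp]
        comm := fun i => hext i fun l => ?_ }
    have hk' : (fun i n => k i n ≫ (π l).f n) = (H l).hom := by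
      ext i n
      exact hk i n l
    rw [Preadditive.add_comp, Preadditive.add_comp, ← dNext_comp_right, ← prevD_comp_right, hk']
    exact (H l).comm i

lemma IsUniversalFan.kInj {J : Type*} {Y : J → KInj A} {P : KInj A} (π : ∀ j, P ⟶ Y j)
    (h : IsUniversalFan fun j => (π j).hom) : IsUniversalFan π := by
  intro T f
  obtain ⟨g, hg, hg'⟩ := h T.obj fun j => (f j).hom
  exact ⟨ObjectProperty.homMk g, fun j => by ext; exact hg j,
    fun b hb => by ext; exact hg' b.hom fun j => congrArg (·.hom) (hb j)⟩

lemma homotopicallyInjective_of_isUniversalFan {J : Type*}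
    {Y : J → HomotopyCategory A (ComplexShape.up ℤ)} {P : HomotopyCategory A (ComplexShape.up ℤ)}
    {π : ∀ j, P ⟶ Y j} (h : IsUniversalFan π) (hY : ∀ j, homotopicallyInjective A (Y j)) :
    homotopicallyInjective A P := fun N f hN =>
  (h N fun _ => 0).unique (fun j => hY j (f ≫ π j) hN) fun _ => zero_comp

/-- The product of complexes, as the complex of the products. -/
def piComplex [HasLimits A] {J : Type} (Y : J → CochainComplex A ℤ) : CochainComplex A ℤ where
  X n := ∏ᶜ fun j => (Y j).X n
  d m n := Limits.Pi.map fun j => (Y j).d m n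
  shape m n h := Limits.Pi.hom_ext _ _ fun j => by simp [(Y j).shape m n h]
  d_comp_d' l m n _ _ := Limits.Pi.hom_ext _ _ fun j => by simp

def piComplexπ [HasLimits A] {J : Type} (Y : J → CochainComplex A ℤ) (j : J) :
    piComplex Y ⟶ Y j where
  f n := Pi.π (fun j => (Y j).X n) j
  comm' m n _ := (Limits.Pi.map_π (fun j => (Y j).d m n) j).symm

lemma isUniversalFan_piComplexπ [HasLimits A] {J : Type} (Y : J → CochainComplex A ℤ) (n : ℤ) :
    IsUniversalFan fun j => (piComplexπ Y j).f n := fun _ f =>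
  ⟨Pi.lift f, fun j => Pi.lift_π _ j, fun _ hb => Pi.hom_ext _ _ fun j =>
    (hb j).trans (Pi.lift_π _ j).symm⟩

end Products

/-! ### Distinguished triangles from degreewise split sequences. -/

section Triangles

variable {A : Type u} [Category.{v} A] [Abelian A]

lemma exists_distTriang_of_splitting {X Y Z : CochainComplex A ℤ} (f : X ⟶ Y) (g : Y ⟶ Z)
    (w : f ≫ g = 0) (r : ∀ n, Y.X n ⟶ X.X n) (s : ∀ n, Z.X n ⟶ Y.X n)
    (f_r : ∀ n, f.f n ≫ r n = 𝟙 _) (s_g : ∀ n, s n ≫ g.f n = 𝟙 _)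
    (id : ∀ n, r n ≫ f.f n + g.f n ≫ s n = 𝟙 _) :
    ∃ b, Triangle.mk ((HomotopyCategory.quotient A (ComplexShape.up ℤ)).map f)
      ((HomotopyCategory.quotient A (ComplexShape.up ℤ)).map g) b ∈
      distTriang (HomotopyCategory A (ComplexShape.up ℤ)) := by
  let S := ShortComplex.mk f g w
  let σ (n : ℤ) : (S.map (HomologicalComplex.eval A _ n)).Splitting :=
    { r := r n, s := s n, f_r := f_r n, s_g := s_g n, id := id n }
  exact ⟨_, (HomotopyCategory.distinguished_iff_iso_trianglehOfDegreewiseSplit _).2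
    ⟨S, σ, ⟨Iso.refl _⟩⟩⟩

/-- Triangles of `K_inj(A)` are tested in `K(A)`; only the third morphism has to be corrected, by
the isomorphism commuting the inclusion with the shift. -/
lemma distTriang_kInj {X Y Z : KInj A} (f : X ⟶ Y) (g : Y ⟶ Z)
    (h : ∃ b, Triangle.mk f.hom g.hom b ∈ distTriang (HomotopyCategory A (ComplexShape.up ℤ))) :
    ∃ b, Triangle.mk f g b ∈ distTriang (KInj A) := by
  obtain ⟨b, hb⟩ := h
  obtain ⟨b', hb'⟩ := ((homotopicallyInjective A).ι).map_surjective
    (b ≫ (((homotopicallyInjective A).ι.commShiftIso (1 : ℤ)).app X).inv)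
  refine ⟨b', ?_⟩
  change (homotopicallyInjective A).ι.mapTriangle.obj (Triangle.mk f g b') ∈
    distTriang (HomotopyCategory A (ComplexShape.up ℤ))
  refine isomorphic_distinguished _ hb _ (Triangle.isoMk _ _ (Iso.refl _) (Iso.refl _) (Iso.refl _)
    ?_ ?_ ?_)
  · exact (Category.comp_id _).trans (Category.id_comp _).symm
  · exact (Category.comp_id _).trans (Category.id_comp _).symm
  · change ((homotopicallyInjective A).ι.map b' ≫
      ((homotopicallyInjective A).ι.commShiftIso (1 : ℤ)).hom.app X) ≫ (𝟙 _)⟦(1 : ℤ)⟧' = 𝟙 _ ≫ b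
    rw [hb', CategoryTheory.Functor.map_id]
    refine Eq.trans (Category.comp_id _) (Eq.trans ?_ (Category.id_comp b).symm)
    exact (Category.assoc _ _ _).trans <| (congrArg (b ≫ ·)
      (((homotopicallyInjective A).ι.commShiftIso (1 : ℤ)).app X).inv_hom_id).trans
      (Category.comp_id _)

end Triangles

/-! ### Split columns are direct factors of products of shifts of `Q`. -/

section Columns

variable {A : Type u} [Category.{v} A] [Abelian A] [HasLimits A] (Q : A)

/-- The complex with zero differential which is a product of copies of `Q`, indexed by the
morphisms `U m ⟶ Q`, in each degree `m`. -/
def coverComplex (U : ℤ → A) : CochainComplex A ℤ where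
  X m := ∏ᶜ fun _ : (U m ⟶ Q) => Q
  d _ _ := 0

variable (U : ℤ → A)

def coverπ (m : ℤ) (a : U m ⟶ Q) : (coverComplex Q U).X m ⟶ Q := Pi.π (fun _ : (U m ⟶ Q) => Q) a

/-- The projections from `coverComplex Q U` to complexes concentrated in one degree. -/
def coverProj (j : Σ m : ℤ, (U m ⟶ Q)) :
    coverComplex Q U ⟶ (CochainComplex.singleFunctor A j.1).obj Q :=
  HomologicalComplex.mkHomToSingle (coverπ Q U j.1 j.2) (fun _ _ => zero_comp)

/-- In degree `n` only the factors placed in degree `n` are nonzero, so the product over all pairs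
reduces to one over `U n ⟶ Q`. -/
lemma isUniversalFan_coverProj (n : ℤ) : IsUniversalFan fun j => (coverProj Q U j).f n := by
  let e : ((CochainComplex.singleFunctor A n).obj Q).X n ≅ Q :=
    HomologicalComplex.singleObjXSelf (ComplexShape.up ℤ) n Q
  have hf (a : U n ⟶ Q) : (coverProj Q U ⟨n, a⟩).f n = coverπ Q U n a ≫ e.inv :=
    HomologicalComplex.mkHomToSingle_f _ _
  intro T f
  let g : T ⟶ (coverComplex Q U).X n := Pi.lift fun a : (U n ⟶ Q) => f ⟨n, a⟩ ≫ e.hom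
  have hg (a : U n ⟶ Q) : g ≫ coverπ Q U n a = f ⟨n, a⟩ ≫ e.hom := Pi.lift_π _ _
  refine ⟨g, ?_, fun b hb => Pi.hom_ext _ _ fun a => Eq.trans ?_ (hg a).symm⟩
  · rintro ⟨m, a⟩
    by_cases h : n = m
    · subst h
      dsimp only
      rw [hf, ← Category.assoc, hg, Category.assoc, e.hom_inv_id, Category.comp_id]
    · exact (HomologicalComplex.isZero_single_obj_X (ComplexShape.up ℤ) m Q n h).eq_of_tgt _ _
  · have hb' : b ≫ (coverProj Q U ⟨n, a⟩).f n = f ⟨n, a⟩ := hb ⟨n, a⟩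
    rw [← hb', hf, Category.assoc, Category.assoc, e.inv_hom_id, Category.comp_id]
    rfl

variable [Injective Q]

/-- The complex with `Q` in degree `m` is the shift `Q[-m]`. -/
def singleIso (m : ℤ) : (HomotopyCategory.quotient A (ComplexShape.up ℤ)).obj
    ((CochainComplex.singleFunctor A m).obj Q) ≅ ((injObj Q)⟦-m⟧).obj :=
  (((HomotopyCategory.singleFunctors A).shiftIso (-m) m 0 (by simp)).app Q).symm ≪≫
    (((homotopicallyInjective A).ι.commShiftIso (-m)).app (injObj Q)).symm

-- The canonical map to a power of `Q` is mono because `Q` cogenerates, and it splits because `V` is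
-- injective.
variable {Q} in
lemma exists_cover (hQ : IsCoseparator Q) (V : A) [Injective V] :
    ∃ (i : V ⟶ ∏ᶜ fun _ : (V ⟶ Q) => Q) (r : (∏ᶜ fun _ : (V ⟶ Q) => Q) ⟶ V), i ≫ r = 𝟙 V := by
  let i : V ⟶ ∏ᶜ fun _ : (V ⟶ Q) => Q := Pi.lift fun a => a
  have hi (a : V ⟶ Q) : i ≫ Pi.π _ a = a := Pi.lift_π _ _
  have : Mono i := ⟨fun a b hab => hQ.def _ _ fun c => by
    rw [← hi c, ← Category.assoc, hab, Category.assoc]⟩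
  exact ⟨i, Injective.factorThru (𝟙 V) i, Injective.comp_factorThru _ _⟩

-- Up to homotopy `K` is `U` with zero differential, a retract of `coverComplex Q U`, which is in
-- `K(A)` the product of the `Q[-m]`. Homotopical injectivity of `K` comes out as a consequence.
variable {Q} in
lemma CESplitting.isProdFactor (hQ : IsCoseparator Q) {K : CochainComplex A ℤ} (σ : CESplitting K)
    (hK : ∀ i, Injective (K.X i)) :
    ∃ h : homotopicallyInjective A ((HomotopyCategory.quotient A (ComplexShape.up ℤ)).obj K),
      IsProdFactor (shiftsOf Q) (⟨_, h⟩ : KInj A) := by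
  have hU := σ.injective_U hK
  let P := coverComplex Q σ.U
  have hP₀ (m n : ℤ) : P.d m n = 0 := rfl
  have hir (m : ℤ) : ∃ (i : σ.U m ⟶ P.X m) (r : P.X m ⟶ σ.U m), i ≫ r = 𝟙 _ :=
    exists_cover hQ (σ.U m)
  choose i r hir using hir
  let q := HomotopyCategory.quotient A (ComplexShape.up ℤ)
  have hP := (isUniversalFan_quotient _ (isUniversalFan_coverProj Q σ.U)).comp_iso
    fun j => singleIso Q j.1
  have hP' := homotopicallyInjective_of_isUniversalFan hP fun j => ((injObj Q)⟦-j.1⟧).property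
  let I : K ⟶ P :=
    { f := fun m => σ.p m ≫ i m
      comm' := fun m n _ => by
        rw [← Category.assoc, σ.d_p, zero_comp, hP₀, comp_zero] }
  let R : P ⟶ K :=
    { f := fun m => r m ≫ σ.s m
      comm' := fun m n _ => by
        rw [Category.assoc, σ.s_d, comp_zero, hP₀, zero_comp] }
  have hIR (m : ℤ) : (I ≫ R).f m = σ.p m ≫ σ.s m := by
    change (σ.p m ≫ i m) ≫ r m ≫ σ.s m = _
    rw [Category.assoc, ← Category.assoc (i m), hir, Category.id_comp]
  have H : Homotopy (𝟙 K) (I ≫ R) :=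
    { hom := fun a b => if b + 1 = a then σ.h a b else 0
      zero := fun a b hab => if_neg hab
      comm := fun n => by
        have := σ.homotopy (n - 1) n (n + 1) (by simp) rfl
        rw [dNext_eq _ (show (ComplexShape.up ℤ).Rel n (n + 1) by simp),
          prevD_eq _ (show (ComplexShape.up ℤ).Rel (n - 1) n by simp), if_pos rfl,
          if_pos (by simp), hIR, this]
        simp }
  have hIR' : q.map I ≫ q.map R = 𝟙 _ := by
    rw [← q.map_comp, ← HomotopyCategory.eq_of_homotopy _ _ H, q.map_id]
  have hK' : homotopicallyInjective A (q.obj K) := fun N f hN => by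
    rw [← Category.comp_id f, ← hIR', ← Category.assoc, hP' (f ≫ q.map I) hN, zero_comp]
  let P' : KInj A := ⟨q.obj P, hP'⟩
  let π (j : Σ m : ℤ, (σ.U m ⟶ Q)) : P' ⟶ (injObj Q)⟦-j.1⟧ :=
    ObjectProperty.homMk (q.map (coverProj Q σ.U j) ≫ (singleIso Q j.1).hom)
  exact ⟨hK', Σ m : ℤ, (σ.U m ⟶ Q), _, Fan.mk P' π,
    fun j => ObjectProperty.ofObj_apply (fun n : ℤ => (injObj Q)⟦n⟧) (-j.1),
    (IsUniversalFan.kInj π hP).nonempty_isLimit,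
    ⟨{ i := ObjectProperty.homMk (q.map I)
       r := ObjectProperty.homMk (q.map R)
       retract := by ext; exact hIR' }⟩⟩

end Columns

/-! ### Total complexes of finitely many columns. -/

section Truncations

variable {A : Type u} [Category.{v} A] [Abelian A] (E : DoubleComplex A)

/-- The formula for the differential of the total complex of the columns `0, …, k` of `E`, applied
to a family of morphisms to the components on an antidiagonal. -/
def totD {E : DoubleComplex A} {k : ℕ} {T : A} {n : ℤ}
    (φ : ∀ (i : ℤ) (j : ℕ), i + j = n → j ≤ k → (T ⟶ (E.X j).X i)) (i : ℤ) :
    ∀ j : ℕ, i + j = n + 1 → j ≤ k → (T ⟶ (E.X j).X i)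
  | 0, h, hj => φ (i - 1) 0 (by omega) hj ≫ (E.X 0).d (i - 1) i
  | j + 1, h, hj => φ (i - 1) (j + 1) (by omega) hj ≫ (E.X (j + 1)).d (i - 1) i +
      i.negOnePow • (φ i j (by push_cast at h; omega) (by omega) ≫ (E.d j (j + 1)).f i)

variable {E} in
lemma comp_totD {k : ℕ} {T T' : A} {n : ℤ} (f : T' ⟶ T)
    (φ : ∀ (i : ℤ) (j : ℕ), i + j = n → j ≤ k → (T ⟶ (E.X j).X i)) (i : ℤ) (j : ℕ)
    (h : i + j = n + 1) (hj : j ≤ k) :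
    f ≫ totD φ i j h hj = totD (fun i j h hj => f ≫ φ i j h hj) i j h hj := by
  cases j <;> simp [totD]

-- The two mixed terms cancel because `(-1)^(i-1) = -(-1)^i`.
variable {E} in
lemma totD_totD {k : ℕ} {T : A} {n : ℤ}
    (φ : ∀ (i : ℤ) (j : ℕ), i + j = n → j ≤ k → (T ⟶ (E.X j).X i)) (i : ℤ) (j : ℕ)
    (h : i + j = n + 1 + 1) (hj : j ≤ k) : totD (totD φ) i j h hj = 0 := by
  have hs : (i - 1).negOnePow = - i.negOnePow := by rw [Int.negOnePow_sub]; simp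
  rcases j with _ | _ | j
  · simp [totD]
  · simp [totD, hs, Preadditive.add_comp]
  · have hd : (E.d j (j + 1)).f i ≫ (E.d (j + 1) (j + 1 + 1)).f i = 0 := by
      rw [← HomologicalComplex.comp_f, E.d_comp_d]; rfl
    simp [totD, hs, hd, Preadditive.add_comp]

variable [HasLimits A] (k : ℕ)

/-- The positions on the antidiagonal `i + j = n` in the columns `0, …, k`. -/
abbrev TruncAntidiag (n : ℤ) : Type := {p : ℤ × ℕ // p.1 + p.2 = n ∧ p.2 ≤ k}

def truncX (n : ℤ) : A := ∏ᶜ fun p : TruncAntidiag k n => (E.X p.1.2).X p.1.1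

def truncπ (n i : ℤ) (j : ℕ) (h : i + j = n) (hj : j ≤ k) : truncX E k n ⟶ (E.X j).X i :=
  Pi.π (fun p : TruncAntidiag k n => (E.X p.1.2).X p.1.1) ⟨(i, j), h, hj⟩

def truncLift {n : ℤ} {T : A} (φ : ∀ (i : ℤ) (j : ℕ), i + j = n → j ≤ k → (T ⟶ (E.X j).X i)) :
    T ⟶ truncX E k n :=
  Pi.lift fun p : TruncAntidiag k n => φ p.1.1 p.1.2 p.2.1 p.2.2

@[simp]
lemma truncLift_π {n : ℤ} {T : A} (φ : ∀ (i : ℤ) (j : ℕ), i + j = n → j ≤ k → (T ⟶ (E.X j).X i))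
    (i : ℤ) (j : ℕ) (h : i + j = n) (hj : j ≤ k) :
    truncLift E k φ ≫ truncπ E k n i j h hj = φ i j h hj := by
  exact Pi.lift_π _ (⟨(i, j), h, hj⟩ : TruncAntidiag k n)

variable {E k} in
lemma trunc_hom_ext {n : ℤ} {T : A} {f g : T ⟶ truncX E k n}
    (hfg : ∀ (i : ℤ) (j : ℕ) (h : i + j = n) (hj : j ≤ k),
      f ≫ truncπ E k n i j h hj = g ≫ truncπ E k n i j h hj) : f = g :=
  Pi.hom_ext _ _ fun p => hfg p.1.1 p.1.2 p.2.1 p.2.2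

def truncD (n : ℤ) : truncX E k n ⟶ truncX E k (n + 1) := truncLift E k (totD (truncπ E k n))

lemma truncD_π (n i : ℤ) (j : ℕ) (h : i + j = n + 1) (hj : j ≤ k) :
    truncD E k n ≫ truncπ E k (n + 1) i j h hj = totD (truncπ E k n) i j h hj := by
  simp [truncD]

/-- The total complex of the columns `0, …, k` of a double complex. -/
def trunc : CochainComplex A ℤ :=
  CochainComplex.of (truncX E k) (truncD E k) fun n => trunc_hom_ext fun i j h hj => by
    rw [Category.assoc, truncD_π, comp_totD]
    simp only [truncD_π]
    rw [totD_totD, zero_comp]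

lemma trunc_d (n : ℤ) : (trunc E k).d n (n + 1) = truncD E k n :=
  CochainComplex.of_d (truncX E k) (truncD E k) n

variable {E k} in
/-- The morphism to the total complex of the columns `0, …, k` with given components. -/
def truncHom {T : CochainComplex A ℤ}
    (φ : ∀ (n i : ℤ) (j : ℕ), i + j = n → j ≤ k → (T.X n ⟶ (E.X j).X i))
    (hφ : ∀ (n i : ℤ) (j : ℕ) (h : i + j = n + 1) (hj : j ≤ k),
      T.d n (n + 1) ≫ φ (n + 1) i j h hj = totD (φ n) i j h hj) : T ⟶ trunc E k where
  f n := truncLift E k (φ n)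
  comm' := by
    rintro n _ rfl
    rw [trunc_d]
    refine trunc_hom_ext fun i j h hj => ?_
    have h₁ : truncLift E k (φ n) ≫ truncD E k n ≫ truncπ E k (n + 1) i j h hj =
        totD (φ n) i j h hj := by
      rw [truncD_π, comp_totD]
      simp only [truncLift_π]
    have h₂ : T.d n (n + 1) ≫ truncLift E k (φ (n + 1)) ≫ truncπ E k (n + 1) i j h hj =
        totD (φ n) i j h hj := by
      rw [truncLift_π, hφ]
    exact (Category.assoc _ _ _).trans (h₁.trans (h₂.symm.trans (Category.assoc _ _ _).symm))

/-- The projection from the total complex of the columns `0, …, k` to a component. -/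
def truncProj (n i : ℤ) (j : ℕ) (h : i + j = n) (hj : j ≤ k) : (trunc E k).X n ⟶ (E.X j).X i :=
  truncπ E k n i j h hj

variable {E k} in
lemma truncProj_ext {n : ℤ} {T : A} {f g : T ⟶ (trunc E k).X n}
    (hfg : ∀ (i : ℤ) (j : ℕ) (h : i + j = n) (hj : j ≤ k),
      f ≫ truncProj E k n i j h hj = g ≫ truncProj E k n i j h hj) : f = g :=
  trunc_hom_ext hfg

variable {E k} in
lemma truncHom_proj {T : CochainComplex A ℤ}
    (φ : ∀ (n i : ℤ) (j : ℕ), i + j = n → j ≤ k → (T.X n ⟶ (E.X j).X i))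
    (hφ : ∀ (n i : ℤ) (j : ℕ) (h : i + j = n + 1) (hj : j ≤ k),
      T.d n (n + 1) ≫ φ (n + 1) i j h hj = totD (φ n) i j h hj)
    (n i : ℤ) (j : ℕ) (h : i + j = n) (hj : j ≤ k) :
    (truncHom φ hφ).f n ≫ truncProj E k n i j h hj = φ n i j h hj :=
  truncLift_π _ _ _ _ _ _ _

variable {k} in
/-- The projections between total complexes. -/
def truncMap {l : ℕ} (hkl : k ≤ l) : trunc E l ⟶ trunc E k :=
  truncHom (fun n i j h hj => truncProj E l n i j h (hj.trans hkl)) fun n i j h hj => by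
    rw [trunc_d]
    refine (truncD_π E l n i j h (hj.trans hkl)).trans ?_
    cases j <;> rfl

/-- The projection from the cototalization to a component. -/
def cotProj (n i : ℤ) (j : ℕ) (h : i + j = n) : (cot E).X n ⟶ (E.X j).X i := cotπ E n i j h

/-- The projection from the cototalization to the total complex of the columns `0, …, k`. -/
def cotToTrunc : cot E ⟶ trunc E k :=
  truncHom (fun n i j h _ => cotProj E n i j h) fun n i j h hj => by
    have hd : (cot E).d n (n + 1) = cotD E n := CochainComplex.of_d (cotX E) (cotD E) n
    rw [hd]
    refine (cotD_π E n i j h).trans ?_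
    cases j <;> rfl

lemma truncMap_π {l : ℕ} (hkl : k ≤ l) (n i : ℤ) (j : ℕ) (h : i + j = n) (hj : j ≤ k) :
    (truncMap E hkl).f n ≫ truncProj E k n i j h hj = truncProj E l n i j h (hj.trans hkl) :=
  truncHom_proj _ _ _ _ _ _ _

lemma cotToTrunc_π (n i : ℤ) (j : ℕ) (h : i + j = n) (hj : j ≤ k) :
    (cotToTrunc E k).f n ≫ truncProj E k n i j h hj = cotProj E n i j h :=
  truncHom_proj _ _ _ _ _ _ _

lemma cotToTrunc_truncMap {l : ℕ} (hkl : k ≤ l) :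
    cotToTrunc E l ≫ truncMap E hkl = cotToTrunc E k := by
  ext n
  refine truncProj_ext fun i j h hj => ?_
  refine (Category.assoc _ _ _).trans ?_
  rw [truncMap_π, cotToTrunc_π, cotToTrunc_π]

/-- The column `E^{•,k}`, placed as a subcomplex of total complexes. -/
def column : CochainComplex A ℤ where
  X n := (E.X k).X (n - k)
  -- No sign appears, as the horizontal differential carries it in the total complex.
  d m n := (E.X k).d (m - k) (n - k)
  shape m n h := (E.X k).shape _ _ fun h' => h (by
    simp only [ComplexShape.up_Rel] at h' ⊢
    omega)
  d_comp_d' _ _ _ _ _ := (E.X k).d_comp_d _ _ _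

/-- The components of the inclusion of a column in a total complex. -/
def columnComp (n i : ℤ) (j : ℕ) (h : i + j = n) (_ : j ≤ k) : (column E k).X n ⟶ (E.X j).X i :=
  if e : j = k then eqToHom (by subst e; obtain rfl : i = n - j := by omega
                                rfl) else 0

lemma columnComp_self (n : ℤ) (h : n - k + k = n) :
    columnComp E k n (n - k) k h le_rfl = 𝟙 ((E.X k).X (n - k)) := by
  simp [columnComp]
  rfl

lemma columnComp_of_ne (n i : ℤ) (j : ℕ) (h : i + j = n) (hj : j ≤ k) (hjk : j ≠ k) :
    columnComp E k n i j h hj = 0 := dif_neg hjk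

lemma columnComp_comm (n i : ℤ) (h : i + k = n + 1) :
    columnComp E k n (i - 1) k (by omega) le_rfl ≫ (E.X k).d (i - 1) i =
      (column E k).d n (n + 1) ≫ columnComp E k (n + 1) i k h le_rfl := by
  obtain rfl : i = n + 1 - k := by omega
  rw [columnComp_self]
  have (m : ℤ) (hm : m = n - k) (hm' : m + k = n) :
      columnComp E k n m k hm' le_rfl ≫ (E.X k).d m (n + 1 - k) =
        (E.X k).d (n - k) (n + 1 - k) := by
    subst hm
    rw [columnComp_self]
    exact Category.id_comp _
  exact (this _ (by omega) (by omega)).trans (Category.comp_id _).symm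

/-- The inclusion of the last column in the total complex of the columns `0, …, k`. -/
def columnι : column E k ⟶ trunc E k :=
  truncHom (columnComp E k) fun n i j h hj => by
    by_cases hjk : j = k
    · subst hjk
      rw [← columnComp_comm]
      cases j with
      | zero => rfl
      | succ j => simp [totD, columnComp_of_ne E (j + 1) n i j (by omega) (by omega) (by omega)]
    · rw [columnComp_of_ne _ _ _ _ _ _ _ hjk, comp_zero]
      cases j with
      | zero => simp [totD, columnComp_of_ne E k n (i - 1) 0 (by omega) (by omega) hjk]
      | succ j =>
        simp [totD, columnComp_of_ne E k n (i - 1) (j + 1) (by omega) (by omega) hjk,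
          columnComp_of_ne E k n i j (by omega) (by omega) (by omega)]

lemma columnι_π (n i : ℤ) (j : ℕ) (h : i + j = n) (hj : j ≤ k) :
    (columnι E k).f n ≫ truncProj E k n i j h hj = columnComp E k n i j h hj :=
  truncHom_proj _ _ _ _ _ _ _

/-- A degreewise retraction of `columnι`. -/
def columnRetr (n : ℤ) : (trunc E k).X n ⟶ (column E k).X n :=
  truncProj E k n (n - k) k (by omega) le_rfl

lemma columnι_columnRetr (n : ℤ) : (columnι E k).f n ≫ columnRetr E k n = 𝟙 _ :=
  (columnι_π E k n _ k _ _).trans (columnComp_self E k n _)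

lemma columnRetr_comp (n i : ℤ) (h : i + k = n) :
    columnRetr E k n ≫ columnComp E k n i k h le_rfl = truncProj E k n i k h le_rfl := by
  obtain rfl : i = n - k := by omega
  rw [columnComp_self]
  exact Category.comp_id _

/-- A degreewise section of `truncMap`. -/
def truncSection (n : ℤ) : (trunc E k).X n ⟶ (trunc E (k + 1)).X n :=
  truncLift E (k + 1) fun i j h _ => if hj : j ≤ k then truncProj E k n i j h hj else 0

lemma truncSection_π (n i : ℤ) (j : ℕ) (h : i + j = n) (hj : j ≤ k + 1) :
    truncSection E k n ≫ truncProj E (k + 1) n i j h hj =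
      if hj : j ≤ k then truncProj E k n i j h hj else 0 :=
  truncLift_π _ _ _ _ _ _ _

lemma truncSection_truncMap (n : ℤ) :
    truncSection E k n ≫ (truncMap E (Nat.le_succ k)).f n = 𝟙 _ := by
  refine truncProj_ext fun i j h hj => (Category.assoc _ _ _).trans ?_
  rw [truncMap_π, truncSection_π, dif_pos hj]
  exact (Category.id_comp _).symm

lemma columnι_truncMap : columnι E (k + 1) ≫ truncMap E (Nat.le_succ k) = 0 := by
  ext n
  refine truncProj_ext fun i j h hj => (Category.assoc _ _ _).trans ?_
  rw [truncMap_π, columnι_π, columnComp_of_ne _ _ _ _ _ _ _ (by omega)]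
  exact zero_comp.symm

lemma trunc_splitting (n : ℤ) : columnRetr E (k + 1) n ≫ (columnι E (k + 1)).f n +
    (truncMap E (Nat.le_succ k)).f n ≫ truncSection E k n = 𝟙 _ := by
  refine truncProj_ext fun i j h hj => ?_
  refine (Preadditive.add_comp _ _ _ _ _ _).trans (Eq.trans ?_ (Category.id_comp _).symm)
  refine (congrArg₂ (· + ·) (Category.assoc _ _ _) (Category.assoc _ _ _)).trans ?_
  rw [columnι_π, truncSection_π]
  by_cases hjk : j = k + 1
  · subst hjk
    rw [columnRetr_comp, dif_neg (by omega)]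
    exact (congrArg (_ + ·) comp_zero).trans (add_zero _)
  · rw [columnComp_of_ne _ _ _ _ _ _ _ hjk, dif_pos (by omega), truncMap_π]
    exact (congrArg (· + _) comp_zero).trans (zero_add _)

lemma columnRetr_columnι_zero (n : ℤ) : columnRetr E 0 n ≫ (columnι E 0).f n = 𝟙 _ := by
  refine truncProj_ext fun i j h hj => (Category.assoc _ _ _).trans ?_
  obtain rfl : j = 0 := by omega
  rw [columnι_π, columnRetr_comp]
  exact (Category.id_comp _).symm

/-- The first column is the total complex of the first column. -/
def columnIsoTrunc : column E 0 ≅ trunc E 0 :=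
  HomologicalComplex.Hom.isoOfComponents (fun n =>
    { hom := (columnι E 0).f n
      inv := columnRetr E 0 n
      hom_inv_id := columnι_columnRetr E 0 n
      inv_hom_id := columnRetr_columnι_zero E n }) (fun _ _ _ => (columnι E 0).comm _ _)

/-- The splitting of a column considered as a subcomplex of total complexes. -/
def columnSplitting (σ : CESplitting (E.X k)) : CESplitting (column E k) where
  U n := σ.U (n - k)
  p n := σ.p (n - k)
  s n := σ.s (n - k)
  h m n := σ.h (m - k) (n - k)
  d_p m n := σ.d_p (m - k) (n - k)
  s_d m n := σ.s_d (m - k) (n - k)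
  s_p n := σ.s_p (n - k)
  homotopy i j l hij hjl := σ.homotopy (i - k) (j - k) (l - k) (by omega) (by omega)

end Truncations

/-! ### Limits of degreewise split towers are homotopy limits. -/

section Towers

variable {A : Type u} [Category.{v} A] [Abelian A]

/-- The limit of a tower of split epimorphisms is the kernel of the split epimorphism `1 - shift`
on the product. -/
lemma exists_splitting_of_tower {Y : ℕ → A} {r : ∀ n, Y (n + 1) ⟶ Y n} (s : ∀ n, Y n ⟶ Y (n + 1))
    (hs : ∀ n, s n ≫ r n = 𝟙 _) {P L : A} {π : ∀ n, P ⟶ Y n} (hπ : IsUniversalFan π)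
    {ρ : ∀ n, L ⟶ Y n}
    (hL : ∀ {T : A} (f : ∀ n, T ⟶ Y n), (∀ n, f (n + 1) ≫ r n = f n) → ∃ g : T ⟶ L,
      ∀ n, g ≫ ρ n = f n)
    (hL' : ∀ {T : A} {f g : T ⟶ L}, (∀ n, f ≫ ρ n = g ≫ ρ n) → f = g)
    {i : L ⟶ P} (hi : ∀ n, i ≫ π n = ρ n) {D : P ⟶ P}
    (hD : ∀ n, D ≫ π n = π n - π (n + 1) ≫ r n) (w : i ≫ D = 0) :
    ∃ (t : P ⟶ L) (σ : P ⟶ P), i ≫ t = 𝟙 _ ∧ σ ≫ D = 𝟙 _ ∧ t ≫ i + D ≫ σ = 𝟙 _ := by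
  have hext {T : A} {a b : T ⟶ P} (hab : ∀ n, a ≫ π n = b ≫ π n) : a = b :=
    (hπ T fun n => b ≫ π n).unique hab fun _ => rfl
  -- The recursion solves `v n - v (n + 1) ≫ r n = π n` with `v 0 = 0`, so the `v n` are the
  -- components of a section of `D`.
  let v (n : ℕ) : P ⟶ Y n := Nat.rec (motive := fun n => P ⟶ Y n) 0
    (fun n v => (v - π n) ≫ s n) n
  have hv (n : ℕ) : v (n + 1) = (v n - π n) ≫ s n := rfl
  obtain ⟨σ, hσ⟩ := (hπ P v).exists
  have hσD : σ ≫ D = 𝟙 _ := hext fun n => by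
    rw [Category.assoc, hD, Preadditive.comp_sub, ← Category.assoc, hσ, hσ, hv, Category.assoc, hs]
    simp
  -- The complementary projection lands in the compatible families, and so factors through `L`.
  have hτ : (𝟙 P - D ≫ σ) ≫ D = 0 := by simp [hσD]
  obtain ⟨t, ht⟩ := hL (fun n => (𝟙 P - D ≫ σ) ≫ π n) fun n => by
    have := congrArg (· ≫ π n) hτ
    simp only [Category.assoc, hD, Preadditive.comp_sub, zero_comp] at this
    simpa using (sub_eq_zero.1 this).symm
  have hti : t ≫ i = 𝟙 P - D ≫ σ := hext fun n => by rw [Category.assoc, hi, ht]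
  refine ⟨t, σ, hL' fun n => ?_, hσD, by rw [hti, sub_add_cancel]⟩
  rw [← hi, Category.assoc, ← Category.assoc t, hti, Preadditive.sub_comp, Preadditive.comp_sub,
    Category.assoc, ← Category.assoc i D, w]
  simp

variable [HasLimits A]

/-- The sequence given by `L` and `1 - shift` on the product splits in each degree, hence gives a
distinguished triangle; the sections `s` need not commute with differentials. -/
lemma isHomotopyLimit_of_tower {Y : ℕ → CochainComplex A ℤ} (r : ∀ n, Y (n + 1) ⟶ Y n)
    (s : ∀ n m, (Y n).X m ⟶ (Y (n + 1)).X m) (hs : ∀ n m, s n m ≫ (r n).f m = 𝟙 _)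
    {L : CochainComplex A ℤ} (ρ : ∀ n, L ⟶ Y n) (hρ : ∀ n, ρ (n + 1) ≫ r n = ρ n)
    (hL : ∀ m {T : A} (f : ∀ n, T ⟶ (Y n).X m), (∀ n, f (n + 1) ≫ (r n).f m = f n) →
      ∃ g : T ⟶ L.X m, ∀ n, g ≫ (ρ n).f m = f n)
    (hL' : ∀ m {T : A} {f g : T ⟶ L.X m}, (∀ n, f ≫ (ρ n).f m = g ≫ (ρ n).f m) → f = g)
    (hY₀ : ∀ n, homotopicallyInjective A
      ((HomotopyCategory.quotient A (ComplexShape.up ℤ)).obj (Y n)))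
    (hL₀ : homotopicallyInjective A ((HomotopyCategory.quotient A (ComplexShape.up ℤ)).obj L)) :
    IsHomotopyLimit (T := KInj A) (fun n => ⟨_, hY₀ n⟩)
      (fun n => ObjectProperty.homMk ((HomotopyCategory.quotient A (ComplexShape.up ℤ)).map (r n)))
      ⟨_, hL₀⟩ := by
  let q := HomotopyCategory.quotient A (ComplexShape.up ℤ)
  let P := piComplex Y
  let π := piComplexπ Y
  have hπ := isUniversalFan_piComplexπ Y
  obtain ⟨i, hi⟩ := exists_lift_of_isUniversalFan π hπ ρ
  obtain ⟨φ, hφ⟩ := exists_lift_of_isUniversalFan π hπ fun n => π (n + 1) ≫ r n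
  let D : P ⟶ P := 𝟙 P - φ
  have hD (n : ℕ) : D ≫ π n = π n - π (n + 1) ≫ r n := by
    rw [Preadditive.sub_comp, Category.id_comp, hφ]
  have w : i ≫ D = 0 := by
    ext m
    refine (hπ m _ fun n => 0).unique (fun n => ?_) fun _ => zero_comp
    change ((i ≫ D) ≫ π n).f m = 0
    rw [Category.assoc, hD, Preadditive.comp_sub, ← Category.assoc, hi, hi, hρ, sub_self]
    rfl
  choose t σ hit hσD hid using fun m => exists_splitting_of_tower (r := fun n => (r n).f m)
    (fun n => s n m) (fun n => hs n m) (hπ m)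
    (ρ := fun n => (ρ n).f m) (hL m) (hL' m) (i := i.f m)
    (fun n => congrArg (fun f => f.f m) (hi n)) (D := D.f m)
    (fun n => congrArg (fun f => f.f m) (hD n)) (congrArg (fun f => f.f m) w)
  have hP := isUniversalFan_quotient π hπ
  have hP₀ := homotopicallyInjective_of_isUniversalFan hP hY₀
  let P' : KInj A := ⟨q.obj P, hP₀⟩
  let Y' (n : ℕ) : KInj A := ⟨q.obj (Y n), hY₀ n⟩
  let π' (n : ℕ) : P' ⟶ Y' n := ObjectProperty.homMk (q.map (π n))
  obtain ⟨hc⟩ := (IsUniversalFan.kInj π' hP).nonempty_isLimit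
  obtain ⟨b, hb⟩ := distTriang_kInj (X := ⟨q.obj L, hL₀⟩) (Y := P') (Z := P')
    (ObjectProperty.homMk (q.map i)) (ObjectProperty.homMk (q.map D))
    (exists_distTriang_of_splitting i D w t σ hit hσD hid)
  let i' : (⟨q.obj L, hL₀⟩ : KInj A) ⟶ P' := ObjectProperty.homMk (q.map i)
  refine ⟨_, hc, i', b, ?_⟩
  let D' : P' ⟶ P' := ObjectProperty.homMk (q.map D)
  let ψ : P' ⟶ P' := Fan.IsLimit.lift hc fun n => π' (n + 1) ≫ ObjectProperty.homMk (q.map (r n))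
  have hψ (n : ℕ) : ψ ≫ π' n = π' (n + 1) ≫ ObjectProperty.homMk (q.map (r n)) :=
    Fan.IsLimit.fac hc _ n
  have hD' : 𝟙 P' - ψ = D' := by
    refine Fan.IsLimit.hom_ext hc _ _ fun n => ?_
    change (𝟙 P' - ψ) ≫ π' n = D' ≫ π' n
    rw [Preadditive.sub_comp, hψ, Category.id_comp]
    ext
    change q.map (π n) - q.map (π (n + 1)) ≫ q.map (r n) = q.map D ≫ q.map (π n)
    rw [← q.map_comp, ← q.map_comp, hD, q.map_sub]
  change Triangle.mk i' D' b ∈ _ at hb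
  rw [← hD'] at hb
  exact hb

end Towers

/-! ### Invariance under isomorphism. -/

section Transport

variable {T : Type u} [Category.{v} T]

lemma IsProdFactor.of_iso {S : ObjectProperty T} {X X' : T} (h : IsProdFactor S X) (e : X ≅ X') :
    IsProdFactor S X' := by
  obtain ⟨J, Y, c, hY, hc, ⟨ρ⟩⟩ := h
  exact ⟨J, Y, c, hY, hc, ⟨(Retract.ofIso e.symm).trans ρ⟩⟩

variable [HasZeroObject T] [HasShift T ℤ] [Preadditive T]
  [∀ n : ℤ, (shiftFunctor T n).Additive] [Pretriangulated T]

lemma IsCofilteredBy.of_iso {S : ObjectProperty T} {X X' : T} (h : IsCofilteredBy S X)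
    (e : X ≅ X') : IsCofilteredBy S X' := by
  obtain ⟨Y, φ, ⟨c, hc, a, b, hab⟩, h₀, h₁⟩ := h
  refine ⟨Y, φ, ⟨c, hc, e.inv ≫ a, b ≫ e.hom⟦(1 : ℤ)⟧', ?_⟩, h₀, h₁⟩
  refine isomorphic_distinguished _ hab _ (Triangle.isoMk _ _ e.symm (Iso.refl _) (Iso.refl _)
    ?_ ?_ ?_)
  · exact Category.comp_id _
  · exact (Category.comp_id _).trans (Category.id_comp _).symm
  · have : (b ≫ e.hom⟦(1 : ℤ)⟧') ≫ e.inv⟦(1 : ℤ)⟧' = b := by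
      rw [Category.assoc, ← Functor.map_comp, e.hom_inv_id, CategoryTheory.Functor.map_id, Category.comp_id]
    exact this.trans (Category.id_comp _).symm

end Transport

/-! ### The cofiltration of a cototalization by its columns. -/

section Cofiltered

variable {A : Type u} [Category.{v} A] [Abelian A] [HasLimits A] {Q : A} [Injective Q]

/-- Degreewise `cot E` is the limit of the tower `trunc E k`, as each component appears at a finite
stage; the layers of the tower are columns, which lie in `Prod(S)`. -/
lemma isCofilteredBy_cot (hQ : IsCoseparator Q) (E : DoubleComplex A)
    (hE : ∀ i j, Injective ((E.X j).X i)) (σ : ∀ j, CESplitting (E.X j))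
    (hE₀ : homotopicallyInjective A
      ((HomotopyCategory.quotient A (ComplexShape.up ℤ)).obj (cot E))) :
    IsCofilteredBy (shiftsOf Q) (⟨_, hE₀⟩ : KInj A) := by
  let q := HomotopyCategory.quotient A (ComplexShape.up ℤ)
  choose hC hC' using fun k => (columnSplitting E k (σ k)).isProdFactor hQ fun i => hE (i - k) k
  have hT (k : ℕ) := exists_distTriang_of_splitting _ _ (columnι_truncMap E k)
    (columnRetr E (k + 1)) (truncSection E k) (columnι_columnRetr E (k + 1))
    (truncSection_truncMap E k) (trunc_splitting E k)
  have hY (k : ℕ) : homotopicallyInjective A (q.obj (trunc E k)) := by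
    induction k with
    | zero => exact (homotopicallyInjective A).prop_of_iso (q.mapIso (columnIsoTrunc E)) (hC 0)
    | succ k hk =>
      obtain ⟨b, hb⟩ := hT k
      exact (homotopicallyInjective A).ext_of_isTriangulatedClosed₂ _ hb (hC (k + 1)) hk
  -- For a compatible family, the component in column `j` is the same at every stage from `j` on;
  -- stage `j` then serves to define the lift to `cot E`.
  have hcomp {m : ℤ} {T : A} (f : ∀ k, T ⟶ (trunc E k).X m)
      (hf : ∀ k, f (k + 1) ≫ (truncMap E (Nat.le_succ k)).f m = f k) (i : ℤ) (j k : ℕ)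
      (h : i + j = m) :
      f (j + k) ≫ truncProj E (j + k) m i j h (by omega) = f j ≫ truncProj E j m i j h le_rfl := by
    induction k with
    | zero => rfl
    | succ k hk =>
      rw [← hk, ← hf (j + k), Category.assoc, truncMap_π]
      rfl
  refine ⟨_, _, isHomotopyLimit_of_tower (fun k => truncMap E (Nat.le_succ k)) (truncSection E)
    (truncSection_truncMap E) (cotToTrunc E) (fun k => cotToTrunc_truncMap E k _) ?_ ?_ hY hE₀,
    ?_, fun k => ?_⟩
  · intro m T f hf
    let g : T ⟶ (cot E).X m := cotLift E m fun i j h => f j ≫ truncProj E j m i j h le_rfl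
    have hg (i : ℤ) (j : ℕ) (h : i + j = m) :
        g ≫ cotProj E m i j h = f j ≫ truncProj E j m i j h le_rfl := cotLift_π _ _ _ _ _ _
    refine ⟨g, fun n => truncProj_ext fun i j h hj => ?_⟩
    rw [Category.assoc, cotToTrunc_π, hg]
    obtain ⟨k, rfl⟩ := Nat.exists_eq_add_of_le hj
    exact (hcomp f hf i j k h).symm
  · intro m T f g hfg
    refine cot_hom_ext E m f g fun i j h => ?_
    change f ≫ cotProj E m i j h = g ≫ cotProj E m i j h
    rw [← cotToTrunc_π E j m i j h le_rfl, ← Category.assoc, hfg, Category.assoc]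
  · exact (hC' 0).of_iso ((homotopicallyInjective A).isoMk (q.mapIso (columnIsoTrunc E)))
  · obtain ⟨b, hb⟩ := distTriang_kInj (X := ⟨q.obj (column E (k + 1)), hC (k + 1)⟩)
      (Y := ⟨q.obj (trunc E (k + 1)), hY (k + 1)⟩) (Z := ⟨q.obj (trunc E k), hY k⟩)
      (ObjectProperty.homMk (q.map (columnι E (k + 1))))
      (ObjectProperty.homMk (q.map (truncMap E (Nat.le_succ k)))) (hT k)
    exact ⟨_, _, b, hC' (k + 1), hb⟩

end Cofiltered

/-! ### Assembly of the five statements. -/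

section Main

variable {A : Type u} [Category.{v} A] [Abelian A] [HasLimits A]

lemma exists_homotopicallyInjectiveResolution [EnoughInjectives A]
    (hCE : CotCEIsHomotopicallyInjectiveResolution A)
    (X : HomotopyCategory A (ComplexShape.up ℤ)) :
    ∃ (E : HomotopyCategory A (ComplexShape.up ℤ)) (f : X ⟶ E),
      IsHomotopicallyInjectiveResolution f := by
  obtain ⟨X, rfl⟩ := HomotopyCategory.quotient_obj_surjective X
  obtain ⟨R, -, -⟩ := exists_ceInjectiveResolution X
  exact ⟨_, _, hCE X R⟩

variable {Q : A} [Injective Q]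

/-- A quasi-isomorphism between homotopically injective complexes is invertible in `K_inj(A)`, so
`X` is isomorphic to the cototalization of a resolution with split columns. -/
lemma isCofilteredBy_shiftsOf [HasDerivedCategory.{w} A] (hQ : IsCoseparator Q)
    (hCE : CotCEIsHomotopicallyInjectiveResolution A) (X : KInj A) :
    IsCofilteredBy (shiftsOf Q) X := by
  have := enoughInjectives_of_isCoseparator Q hQ
  obtain ⟨K, hK⟩ := HomotopyCategory.quotient_obj_surjective X.obj
  obtain ⟨R, hR, hσ⟩ := exists_ceInjectiveResolution K
  obtain ⟨hq, hE⟩ := hCE K R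
  let C : KInj A := ⟨_, hE⟩
  let f : C.obj ⟶ C.obj := 𝟙 _
  have hX : homotopicallyInjective A ((HomotopyCategory.quotient A (ComplexShape.up ℤ)).obj K) := by
    rw [hK]
    exact X.property
  obtain rfl : X = ⟨_, hX⟩ := by
    obtain ⟨X, _⟩ := X
    subst hK
    rfl
  let g : (⟨_, hX⟩ : KInj A) ⟶ C := ObjectProperty.homMk
    ((HomotopyCategory.quotient A (ComplexShape.up ℤ)).map (toCot R.ε R.ε_comp_d))
  have : IsIso ((KInjToDerived A).map g) :=
    Localization.inverts DerivedCategory.Qh (HomotopyCategory.quasiIso A (ComplexShape.up ℤ)) _ hq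
  have : IsIso g := isIso_of_reflects_iso g (KInjToDerived A)
  exact (isCofilteredBy_cot hQ R.E hR (fun j => (hσ j).some) hE).of_iso (asIso g).symm

lemma hasProducts_kInj [HasDerivedCategory.{w} A] [HasProducts.{v} (DerivedCategory A)]
    [(KInjToDerived A).IsEquivalence] : HasProducts.{v} (KInj A) := fun _ =>
  Adjunction.hasLimitsOfShape_of_equivalence (KInjToDerived A)

end Main

end CartanEilenberg

end

theorem mainTheorem2 {A : Type u} [Category.{v} A] [Abelian A] [HasLimits A]
    (Q : A) [Injective Q] (hQ : IsCoseparator Q)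
    [HasDerivedCategory.{w} A] [HasProducts.{v} (DerivedCategory A)]
    (hCE : CartanEilenberg.CotCEIsHomotopicallyInjectiveResolution A) :
    (∀ X : HomotopyCategory A (ComplexShape.up ℤ),
      ∃ (E : HomotopyCategory A (ComplexShape.up ℤ)) (f : X ⟶ E),
        CartanEilenberg.IsHomotopicallyInjectiveResolution f) ∧
    (((CartanEilenberg.homotopicallyInjective A).ι ⋙ DerivedCategory.Qh).IsEquivalence ∧
      LocallySmall.{v} (DerivedCategory A)) ∧
    (∀ (B : Type u') [Category.{v'} B] [Abelian B] [HasDerivedCategory.{w'} B]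
      (F : A ⥤ B) [F.Additive] [PreservesFiniteLimits F],
        CartanEilenberg.HasTotalRightDerivedFunctor F) ∧
    CartanEilenberg.OpSatisfiesBrownRepresentability.{v} (DerivedCategory A) ∧
    (∀ X : CartanEilenberg.KInj A,
      CartanEilenberg.IsCofilteredBy (CartanEilenberg.shiftsOf Q) X) := by
  have := CartanEilenberg.enoughInjectives_of_isCoseparator Q hQ
  have hA := CartanEilenberg.exists_homotopicallyInjectiveResolution hCE
  have := CartanEilenberg.KInjToDerived_isEquivalence hA
  have := CartanEilenberg.hasProducts_kInj (A := A)
  have hcof := CartanEilenberg.isCofilteredBy_shiftsOf hQ hCE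
  exact ⟨hA, ⟨‹_›, CartanEilenberg.locallySmall_derivedCategory hA⟩,
    fun B _ _ _ F _ _ => CartanEilenberg.hasTotalRightDerivedFunctor hA F,
    CartanEilenberg.opSatisfiesBrownRepresentability_derivedCategory A fun H _ hH =>
      CartanEilenberg.exists_universal_element hH
        (fun n : ℤ => (CartanEilenberg.injObj Q)⟦n⟧) hcof,
    hcof⟩
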